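/- **Setting.** A full binary tree is a finite rooted tree in which every node has exactly $2$ or $0$ children. An LCL problem on full binary trees is a pair $(\Sigma,\mathcal C)$ of a finite label set $\Sigma$ and a set $\mathcal C$ of allowed configurations $(\sigma:\sigma',\sigma'')$ with $\sigma,\sigma',\sigma''\in\Sigma$. A solution on a tree $T$ labels every node with an element of $\Sigma$ so that for every node $v$ with two children, the children can be ordered as $u',u''$ such that $(\lambda(v):\lambda(u'),\lambda(u''))\in\mathcal C$; leaves are unconstrained. For an integer $k\ge 1$ let $\Pi_k$ be the LCL problem with labels $\Sigma_k=\{a_1,b_1,x_1,\dots,a_{k-1},b_{k-1},x_{k-1},a_k,b_k\}$ whose allowed configurations are the following, where $\Sigma_{<i}=\{a_j,b_j,x_j : 1\le j<i\}$: - $(a_i:\sigma,\sigma')$ for $1\le i\le k$ and $\sigma,\sigma'\in\Sigma_{<i}\cup\{b_i\}$; - $(b_i:\sigma,\sigma')$ for $1\le i\le k$ and $\sigma,\sigma'\in\Sigma_{<i}\cup\{a_i\}$; - $(x_i:\sigma,\sigma')$ for $1\le i\le k-1$, $\sigma\in\Sigma_k$ and $\sigma'\in\Sigma_{<i}\cup\{a_i,b_i\}$.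 In the $\mathsf{LOCAL}$ model the nodes of an $n$-node tree have distinct identifiers from $\{1,\dots,n^c\}$, for a fixed integer $c\ge1$. Initially a node knows $n$, its identifier, its degree and which of its incident edges leads to its parent. In each synchronous round it exchanges messages of arbitrary size with its neighbours and performs arbitrary local computation. In the $\mathsf{CONGEST}$ model messages have $O(\log n)$ bits. A deterministic algorithm has to produce a solution on every tree with every choice of identifiers. In a randomized algorithm each node also has its own stream of independent fair random bits, and on every $n$-node tree with every choice of identifiers the output has to be a solution with probability at least $1-1/n$. The running time $T(n)$ is the number of rounds after which all nodes of every $n$-node tree have produced their output. **Theorem.** For every integer $k\ge 1$ (and every $c\ge1$), the round complexity of $\Pi_k$ is $\Theta(n^{1/k})$ in both $\mathsf{LOCAL}$ and $\mathsf{CONGEST}$, for deterministic as well as for randomized algorithms. That is, in each of these four models there is an algorithm that solves $\Pi_k$ in $O(n^{1/k})$ rounds on $n$-node full binary trees, and there are a constant $\gamma>0$ and an $n_0$ such that every algorithm that solves $\Pi_k$ has running time at least $\gamma n^{1/k}$ for every odd $n\ge n_0$ (a full binary tree has an odd number of nodes). -/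

import Mathlib

open MeasureTheory

/-- A finite full `δ`-ary rooted tree: every node has either `0` or exactly `δ` children.
The children of a node are listed as `0, …, δ - 1`; this is only a port numbering, which lets
a node tell its incident edges apart (algorithms have to work for every port numbering, and
the notion of a solution below does not depend on it). -/
inductive FullTree (δ : ℕ) : Type where
  | leaf : FullTree δ
  | node (children : Fin δ → FullTree δ) : FullTree δ

namespace FullTree

variable {δ : ℕ}

/-- The nodes of a tree, given by their addresses. The address of the root is `[]`, and the
`i`-th child of the node with address `p` has address `i :: p` (so the step that was taken
last on the way down from the root is the head of the list). -/
def nodes : FullTree δ → Finset (List (Fin δ))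
  | leaf => {[]}
  | node c => insert [] (Finset.univ.biUnion fun i => (nodes (c i)).image fun p => p ++ [i])

/-- The number of nodes. -/
def size (t : FullTree δ) : ℕ := t.nodes.card

theorem nil_mem_nodes (t : FullTree δ) : ([] : List (Fin δ)) ∈ t.nodes := by
  cases t <;> simp [nodes]

theorem mem_nodes_of_cons_mem (t : FullTree δ) :
    ∀ (i : Fin δ) (p : List (Fin δ)), i :: p ∈ t.nodes → p ∈ t.nodes := by
  induction t with
  | leaf => intro i p h; simp [nodes] at h
  | node c ih =>
    intro i p h
    simp only [nodes, Finset.mem_insert, Finset.mem_biUnion, Finset.mem_univ, true_and,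
      Finset.mem_image, reduceCtorEq, false_or] at h ⊢
    obtain ⟨j, q, hq, he⟩ := h
    cases q with
    | nil =>
      simp only [List.nil_append, List.cons.injEq] at he
      exact Or.inl he.2.symm
    | cons i' q' =>
      simp only [List.cons_append, List.cons.injEq] at he
      exact Or.inr ⟨j, q', ih j i' q' hq, he.2⟩

/-- The type of nodes of a tree. -/
abbrev Node (t : FullTree δ) : Type := {p : List (Fin δ) // p ∈ t.nodes}

/-- The `i`-th child of a node, if the node has children. -/
def child? (t : FullTree δ) (v : t.Node) (i : Fin δ) : Option t.Node :=
  if h : i :: v.1 ∈ t.nodes then some ⟨i :: v.1, h⟩ else none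

/-- The parent `u` of a node, together with the index `i` such that the node is the `i`-th
child of `u`; `none` for the root. -/
def parent? (t : FullTree δ) : t.Node → Option (t.Node × Fin δ)
  | ⟨[], _⟩ => none
  | ⟨i :: p, h⟩ => some (⟨p, t.mem_nodes_of_cons_mem i p h⟩, i)

end FullTree

/-- An LCL problem `(δ, Σ, C)` on full `δ`-ary rooted trees: a finite set of labels and a set
of allowed configurations `(a : b₁, …, b_δ)`. -/
structure LCL where
  δ : ℕ
  Label : Type
  finite_label : Finite Label
  config : Set (Label × (Fin δ → Label))

/-- A labeling solves the problem if at every node with children `v₁, …, v_δ` the labels of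
the children can be permuted so that an allowed configuration results. Leaves are
unconstrained. -/
def LCL.IsSolution (P : LCL) (t : FullTree P.δ) (lab : t.Node → P.Label) : Prop :=
  ∀ (v : t.Node) (w : Fin P.δ → t.Node), (∀ i, t.child? v i = some (w i)) →
    ∃ ρ : Equiv.Perm (Fin P.δ), (lab v, fun i => lab (w (ρ i))) ∈ P.config

/-- A synchronous message-passing algorithm on full `δ`-ary rooted trees with outputs in `L`.
The local computation is unrestricted. Initially a node knows the number `n` of nodes of the
tree, its own identifier, whether it has a parent, whether it has children (these two
determine its degree) and its own stream of random bits. In each round it sends one message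
to its parent and one to each of its children, receives the messages that its parent and its
children sent to it in the same round, and updates its state. -/
structure Algorithm (δ : ℕ) (L : Type) where
  State : Type
  Msg : Type
  init : (n : ℕ) → (ident : ℕ) → (hasParent : Bool) → (hasChildren : Bool) → (ℕ → Bool) → State
  toParent : State → Msg
  toChild : State → Fin δ → Msg
  update : State → (fromParent : Option Msg) → (fromChild : Fin δ → Option Msg) → State
  output : State → L

namespace Algorithm

variable {δ : ℕ} {L : Type}

/-- The state of each node after `r` rounds on the tree `t`, with the identifiers `ident` and
the random bits `ω`. -/
def run (A : Algorithm δ L) (t : FullTree δ) (ident : t.Node → ℕ) (ω : t.Node → ℕ → Bool) :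
    ℕ → t.Node → A.State
  | 0 => fun v =>
      A.init t.size (ident v) (t.parent? v).isSome (decide (∃ i, (t.child? v i).isSome)) (ω v)
  | r + 1 => fun v =>
      A.update (run A t ident ω r v)
        ((t.parent? v).map fun ui => A.toChild (run A t ident ω r ui.1) ui.2)
        (fun i => (t.child? v i).map fun w => A.toParent (run A t ident ω r w))

/-- The labeling that the nodes output after `r` rounds. -/
def result (A : Algorithm δ L) (t : FullTree δ) (ident : t.Node → ℕ) (ω : t.Node → ℕ → Bool)
    (r : ℕ) (v : t.Node) : L :=
  A.output (A.run t ident ω r v)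

/-- A deterministic algorithm makes no use of its random bits. -/
def IsDeterministic (A : Algorithm δ L) : Prop :=
  ∀ n ident hasParent hasChildren s s',
    A.init n ident hasParent hasChildren s = A.init n ident hasParent hasChildren s'

end Algorithm

/-- Admissible identifiers: pairwise distinct elements of `{1, …, n ^ c}`, where `n` is the
number of nodes. -/
def ValidIds (c : ℕ) {δ : ℕ} (t : FullTree δ) (ident : t.Node → ℕ) : Prop :=
  Function.Injective ident ∧ ∀ v, 1 ≤ ident v ∧ ident v ≤ t.size ^ c

/-- Messages of `O(log n)` bits: under some encoding of the messages by bit strings, all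
messages in the first `T n` rounds on trees with `n` nodes have length at most a constant times
the number `⌊log₂ n⌋ + 1` of binary digits of `n`. -/
def HasSmallMessages (c : ℕ) {δ : ℕ} {L : Type} (A : Algorithm δ L) (T : ℕ → ℕ) : Prop :=
  ∃ enc : A.Msg → List Bool, Function.Injective enc ∧
    ∃ B : ℕ, ∀ (t : FullTree δ) (ident : t.Node → ℕ), ValidIds c t ident →
      ∀ (ω : t.Node → ℕ → Bool) (r : ℕ), r < T t.size → ∀ v : t.Node,
        (enc (A.toParent (A.run t ident ω r v))).length ≤ B * (Nat.log 2 t.size + 1) ∧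
        ∀ i, (enc (A.toChild (A.run t ident ω r v) i)).length ≤ B * (Nat.log 2 t.size + 1)

/-- The law of an infinite stream of independent fair random bits. -/
noncomputable def coinStream : Measure (ℕ → Bool) :=
  Measure.infinitePi fun _ : ℕ => (PMF.uniformOfFintype Bool).toMeasure

/-- The communication model: messages of unbounded size, or of `O(log n)` bits. -/
inductive Bandwidth : Type where
  | LOCAL
  | CONGEST

/-- Deterministic algorithms, or randomized (Monte Carlo) algorithms. -/
inductive Randomness : Type where
  | deterministic
  | randomized

/-- The algorithm `A` solves the problem `P` in `T n` rounds on trees with `n` nodes, in the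
given model and with identifiers from `{1, …, n ^ c}`. A deterministic algorithm must always
produce a solution. A randomized one must, for each tree and all identifiers, fail with
probability at most `1 / n`, where the nodes have independent streams of fair random bits. (No
measurability is required of `A`; if the event of failure is not measurable, then its
probability is its outer measure.) -/
def Solves (b : Bandwidth) (ρ : Randomness) (c : ℕ) (P : LCL) (A : Algorithm P.δ P.Label)
    (T : ℕ → ℕ) : Prop :=
  (match b with
    | .LOCAL => True
    | .CONGEST => HasSmallMessages c A T) ∧
  (match ρ with
    | .deterministic =>
        A.IsDeterministic ∧
        ∀ (t : FullTree P.δ) (ident : t.Node → ℕ), ValidIds c t ident →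
          ∀ ω : t.Node → ℕ → Bool, P.IsSolution t (A.result t ident ω (T t.size))
    | .randomized =>
        ∀ (t : FullTree P.δ) (ident : t.Node → ℕ), ValidIds c t ident →
          (Measure.pi fun _ : t.Node => coinStream)
            {ω | ¬ P.IsSolution t (A.result t ident ω (T t.size))} ≤ 1 / (t.size : ENNReal))

/-- The round complexity of `P` is `Θ(f)`. Upper bound: some algorithm solves `P` in `O(f n)`
rounds. Lower bound: there is a constant `γ > 0` such that every algorithm that solves `P`
needs at least `γ * f n` rounds, for all sufficiently large `n` for which there are full
`δ`-ary trees with `n` nodes at all. -/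
def HasRoundComplexityTheta (b : Bandwidth) (ρ : Randomness) (c : ℕ) (P : LCL)
    (f : ℕ → ℝ) : Prop :=
  (∃ (A : Algorithm P.δ P.Label) (T : ℕ → ℕ), Solves b ρ c P A T ∧
    ∃ K : ℝ, ∀ n : ℕ, 1 ≤ n → (T n : ℝ) ≤ K * f n) ∧
  (∃ γ : ℝ, 0 < γ ∧ ∃ n₀ : ℕ, ∀ (A : Algorithm P.δ P.Label) (T : ℕ → ℕ), Solves b ρ c P A T →
    ∀ n : ℕ, n₀ ≤ n → (∃ t : FullTree P.δ, t.size = n) → γ * f n ≤ (T n : ℝ))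

/-- The labels `a₁, b₁, x₁, …, a_{k-1}, b_{k-1}, x_{k-1}, a_k, b_k`. -/
inductive PolyLabel (k : ℕ) : Type where
  | a (i : ℕ) (one_le : 1 ≤ i) (le : i ≤ k) : PolyLabel k
  | b (i : ℕ) (one_le : 1 ≤ i) (le : i ≤ k) : PolyLabel k
  | x (i : ℕ) (one_le : 1 ≤ i) (lt : i < k) : PolyLabel k

namespace PolyLabel

variable {k : ℕ}

/-- The index `i` of a label `a_i`, `b_i` or `x_i`. -/
def index : PolyLabel k → ℕ
  | a i _ _ => i
  | b i _ _ => i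
  | x i _ _ => i

theorem finite (k : ℕ) : Finite (PolyLabel k) := by
  let g : PolyLabel k → Fin 3 × Fin (k + 1) := fun l => match l with
    | a i _ h => (0, ⟨i, by omega⟩)
    | b i _ h => (1, ⟨i, by omega⟩)
    | x i _ h => (2, ⟨i, by omega⟩)
  refine Finite.of_injective g ?_
  intro l l' h
  cases l <;> cases l' <;> simp_all [g]

/-- The allowed configurations `(l : s, s')`. For `a_i` both `s` and `s'` are `b_i` or a label
of index less than `i`; for `b_i` likewise with `a_i`; for `x_i` the label `s` is arbitrary and
`s'` is `a_i` or `b_i` or a label of index less than `i`. -/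
def Allowed : PolyLabel k → PolyLabel k → PolyLabel k → Prop
  | a i h₁ h₂, s, s' => (s.index < i ∨ s = b i h₁ h₂) ∧ (s'.index < i ∨ s' = b i h₁ h₂)
  | b i h₁ h₂, s, s' => (s.index < i ∨ s = a i h₁ h₂) ∧ (s'.index < i ∨ s' = a i h₁ h₂)
  | x i h₁ h₂, _, s' => s'.index < i ∨ s' = a i h₁ h₂.le ∨ s' = b i h₁ h₂.le

end PolyLabel

/-- The problem `Π_k` on full binary trees. -/
def polyProblem (k : ℕ) : LCL where
  δ := 2
  Label := PolyLabel k
  finite_label := PolyLabel.finite k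
  config := {q | PolyLabel.Allowed q.1 (q.2 0) (q.2 1)}

/-! Upper bound. Put `τ = ⌈n^(1/k)⌉` and peel the tree in `k` phases. In phase `i` an unlabelled
node is small if every downward path of unlabelled nodes from it has at most `τ` nodes. Components
of small nodes are 2-coloured from the top with `a_i` and `b_i`; for `i < k`, a node that is not
small but has a labelled or small child takes `x_i`. A node that survives has two unlabelled
children that are not small, and summing the potential "height of the unlabelled part, capped at
`τ`" shows that each of the first `k - 1` phases divides the number of unlabelled nodes by `τ`
(`card_next_mul_le`). So at most `τ` nodes remain for phase `k`, and all of them are small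
(`labels_ne_none`). The algorithm is deterministic with messages of constant size, so it serves all
four models.

Lower bound. It suffices to treat randomized algorithms in `LOCAL`. Call `a_j`, `b_j` with `j ≤ i`
and `x_j` with `j < i` low of level `i`. On a long path whose hanging subtrees have roots that are
not low of level `i`, a first node that is low of level `i + 1` forces the path to alternate between
`a_{i+1}` and `b_{i+1}` (`path_alternates`). A fast algorithm cannot do this: permuting identifiers
and random bits so that the surroundings of a far path node move down by one, while the view of the
first node stays the same, breaks the parity. Hence in trees of nested spines of length `L` the
probability of being low grows per level by a factor of order `L` only, from `0` at level `0`
(`measure_low_spine_le`, `measure_low_nested_le`). At level `k` every label is low, so `1` is at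
most about `L^(k-1) / n` up to a constant factor, which fails for `L` of order `n^(1/k)` and `n`
large. -/

namespace FullTree

variable {δ : ℕ}

/-! ### Addresses, children and parents. -/

theorem mem_nodes_node {c : Fin δ → FullTree δ} {p : List (Fin δ)} :
    p ∈ (node c).nodes ↔ p = [] ∨ ∃ i, ∃ q ∈ (c i).nodes, q ++ [i] = p := by
  simp [nodes]

theorem concat_mem_nodes_node {c : Fin δ → FullTree δ} {i : Fin δ} {q : List (Fin δ)} :
    q ++ [i] ∈ (node c).nodes ↔ q ∈ (c i).nodes := by
  rw [mem_nodes_node]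
  constructor
  · rintro (h | ⟨j, r, hr, h⟩)
    · simp at h
    · obtain ⟨rfl, h⟩ := List.append_inj' h rfl
      obtain rfl : j = i := by simpa using h
      exact hr
  · exact fun h => Or.inr ⟨i, q, h, rfl⟩

theorem sibling_mem_nodes (t : FullTree δ) :
    ∀ (i j : Fin δ) (p : List (Fin δ)), i :: p ∈ t.nodes → j :: p ∈ t.nodes := by
  induction t with
  | leaf => intro i j p h; simp [nodes] at h
  | node c ih =>
    intro i j p h
    rcases p.eq_nil_or_concat with rfl | ⟨q, l, rfl⟩
    · exact concat_mem_nodes_node.2 (nil_mem_nodes (c j))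
    · rw [List.concat_eq_append, ← List.cons_append, concat_mem_nodes_node] at h ⊢
      exact ih l i j q h

theorem child?_eq_some {t : FullTree δ} {v w : t.Node} {i : Fin δ} :
    t.child? v i = some w ↔ w.1 = i :: v.1 := by
  unfold child?
  split_ifs with h
  · simp [Subtype.ext_iff, eq_comm]
  · simp only [false_iff]
    exact fun hw => h (hw ▸ w.2)

theorem child?_eq_none {t : FullTree δ} {v : t.Node} {i : Fin δ} :
    t.child? v i = none ↔ i :: v.1 ∉ t.nodes := by
  unfold child?
  split_ifs with h <;> simp [h]

theorem parent?_eq_some {t : FullTree δ} {v w : t.Node} {i : Fin δ} :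
    t.parent? w = some (v, i) ↔ w.1 = i :: v.1 := by
  obtain ⟨p, hp⟩ := w
  cases p with
  | nil => simp [parent?]
  | cons j q =>
    simp [parent?, Subtype.ext_iff, and_comm]

theorem parent?_eq_none {t : FullTree δ} {w : t.Node} : t.parent? w = none ↔ w.1 = [] := by
  obtain ⟨p, hp⟩ := w
  cases p <;> simp [parent?]

theorem exists_child_of_child {t : FullTree δ} {v w : t.Node} {i : Fin δ}
    (h : t.child? v i = some w) (j : Fin δ) : ∃ u, t.child? v j = some u :=
  ⟨⟨j :: v.1, t.sibling_mem_nodes i j v.1 (child?_eq_some.1 h ▸ w.2)⟩, child?_eq_some.2 rfl⟩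

theorem child?_injective {t : FullTree δ} {v v' w : t.Node} {i i' : Fin δ}
    (h : t.child? v i = some w) (h' : t.child? v' i' = some w) : v = v' ∧ i = i' := by
  rw [child?_eq_some] at h h'
  rw [h] at h'
  simp only [List.cons.injEq] at h'
  exact ⟨Subtype.ext h'.2, h'.1⟩

end FullTree

/-! ### The algorithm -/

namespace Peeling

open FullTree

variable {k : ℕ}

/-- The part of the state of a node that it sends to its neighbours: its label (if it already has
one), whether it is known to be small in the current phase, and its colour in the current phase. -/
abbrev Flags (k : ℕ) : Type := Option (PolyLabel k) × Bool × Option Bool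

/-- A child is done if it has a label or is small. -/
def done (m : Option (PolyLabel k) × Bool) : Bool := m.1.isSome || m.2

def allDone (ch : Fin 2 → Option (Option (PolyLabel k) × Bool)) : Bool :=
  decide (∀ i, (ch i).all done = true)

def someDone (ch : Fin 2 → Option (Option (PolyLabel k) × Bool)) : Bool :=
  decide (∃ i, (ch i).any done = true)

/-- The colour of a node, given the flags of its parent. -/
def colorFrom (par : Option (Flags k)) : Option Bool :=
  match par with
  | none => some true
  | some m => if m.1.isSome || !m.2.1 then some true else m.2.2.map not

/-- The label that an unlabelled node takes at the end of phase `q`. -/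
def pick (q : ℕ) (small : Bool) (col : Option Bool)
    (ch : Fin 2 → Option (Option (PolyLabel k) × Bool)) : Option (PolyLabel k) :=
  if h : q + 1 ≤ k then
    if small = true then
      if col = some true then some (.a (q + 1) q.succ_pos h) else some (.b (q + 1) q.succ_pos h)
    else if h' : q + 1 < k then
      if someDone ch = true then some (.x (q + 1) q.succ_pos h') else none
    else none
  else none

/-! ### The phases as functions on the tree, and correctness of the partial labelings. -/

section Semantics

variable (t : FullTree 2) (D : t.Node → Option (PolyLabel k))

def childFlags (S : t.Node → Bool) (v : t.Node) : Fin 2 → Option (Option (PolyLabel k) × Bool) :=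
  fun i => (t.child? v i).map fun w => (D w, S w)

/-- Whether a node is found to be small within `s` rounds, where the nodes in the domain of `D` are
removed from the tree. -/
def small : ℕ → t.Node → Bool
  | 0 => fun _ => false
  | s + 1 => fun v => allDone (childFlags t D (small s) v)

/-- The alternating colouring of the components of small nodes after `s` rounds. -/
def color (S : t.Node → Bool) : ℕ → t.Node → Option Bool
  | 0 => fun _ => none
  | s + 1 => fun v => colorFrom ((t.parent? v).map fun u => (D u.1, S u.1, color S s u.1))

/-- The labels after phase `q`, given the labels before it. -/
def next (τ q : ℕ) (v : t.Node) : Option (PolyLabel k) :=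
  (D v).or (pick q (small t D τ v) (color t D (small t D τ) (τ + 1) v)
    (childFlags t D (small t D τ) v))

/-- The labels after `q` phases. -/
def labels (k : ℕ) (t : FullTree 2) (τ : ℕ) : ℕ → t.Node → Option (PolyLabel k)
  | 0 => fun _ => none
  | q + 1 => next t (labels k t τ q) τ q

variable {t D}

theorem small_succ_eq_true {s : ℕ} {v : t.Node} :
    small t D (s + 1) v = true ↔
      ∀ i w, t.child? v i = some w → (D w).isSome = true ∨ small t D s w = true := by
  change allDone (childFlags t D (small t D s) v) = true ↔ _
  rw [allDone, decide_eq_true_iff]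
  refine forall_congr' fun i => ?_
  rw [childFlags]
  cases t.child? v i <;> simp [done]

theorem someDone_eq_true {S : t.Node → Bool} {v : t.Node} :
    someDone (childFlags t D S v) = true ↔
      ∃ i w, t.child? v i = some w ∧ ((D w).isSome = true ∨ S w = true) := by
  rw [someDone, decide_eq_true_iff]
  refine exists_congr fun i => ?_
  rw [childFlags]
  cases t.child? v i <;> simp [done]

theorem small_mono_succ (s : ℕ) : ∀ v, small t D s v = true → small t D (s + 1) v = true := by
  induction s with
  | zero => simp [small]
  | succ s ih =>
    intro v hv
    rw [small_succ_eq_true] at hv ⊢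
    exact fun i w hw => (hv i w hw).imp_right (ih w)

theorem small_mono {s s' : ℕ} (h : s ≤ s') {v : t.Node} (hv : small t D s v = true) :
    small t D s' v = true := by
  induction h with
  | refl => exact hv
  | step _ ih => exact small_mono_succ _ _ ih

theorem color_succ_of_child {S : t.Node → Bool} {s : ℕ} {v w : t.Node} {i : Fin 2}
    (h : t.child? v i = some w) (hD : D v = none) (hS : S v = true) :
    color t D S (s + 1) w = (color t D S s v).map not := by
  have : t.parent? w = some (v, i) := parent?_eq_some.2 (child?_eq_some.1 h)
  simp [color, colorFrom, this, hD, hS]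

theorem color_mono_succ {S : t.Node → Bool} (s : ℕ) :
    ∀ v b, color t D S s v = some b → color t D S (s + 1) v = some b := by
  induction s with
  | zero => simp [color]
  | succ s ih =>
    intro v b hv
    rw [color] at hv ⊢
    rcases hp : t.parent? v with _ | ⟨u, i⟩
    · simpa [hp] using hv
    · simp only [hp, Option.map_some, colorFrom] at hv ⊢
      split_ifs at hv ⊢ with h
      · exact hv
      · cases hc : color t D S s u with
        | none => simp [hc] at hv
        | some c => rw [ih u c hc]; simpa [hc] using hv

/-- Colours travel down from the top of a component. A node still uncoloured after `s` rounds has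
`s` small uncoloured ancestors above it, and each step down lowers the number of rounds needed to be
found small by one. For `s = τ` nothing is left, so `τ` rounds colour every small node. -/
theorem small_of_color_eq_none {τ s : ℕ} (hs : s ≤ τ) :
    ∀ v, D v = none → small t D τ v = true → color t D (small t D τ) s v = none →
      small t D (τ - s) v = true := by
  induction s with
  | zero => exact fun v _ h _ => h
  | succ s ih =>
    intro v hD hv hc
    rw [color] at hc
    rcases hp : t.parent? v with _ | ⟨u, i⟩
    · simp [hp, colorFrom] at hc
    · simp only [hp, Option.map_some, colorFrom] at hc
      split_ifs at hc with h
      simp only [Bool.or_eq_true, not_or, Bool.not_eq_true, Option.isSome_eq_false_iff,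
        Option.isNone_iff_eq_none, Bool.not_eq_false', Option.map_eq_none_iff] at h hc
      have hu := ih (by omega) u h.1 h.2 hc
      obtain ⟨r, hr⟩ : ∃ r, τ - s = r + 1 := ⟨τ - s - 1, by omega⟩
      rw [hr, small_succ_eq_true] at hu
      have := hu i v (child?_eq_some.2 (parent?_eq_some.1 hp))
      rw [show τ - (s + 1) = r by omega]
      simpa [hD] using this

theorem exists_color {τ : ℕ} {v : t.Node} (hD : D v = none) (hv : small t D τ v = true) :
    ∃ b, color t D (small t D τ) τ v = some b := by
  by_contra! h
  have := small_of_color_eq_none le_rfl v hD hv (Option.eq_none_iff_forall_ne_some.2 h)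
  simp [small] at this

/-- The requirement of a label on partially labelled children. -/
def AllowedPartial (l : PolyLabel k) (s s' : Option (PolyLabel k)) : Prop :=
  match l with
  | .a i h₁ h₂ => (∃ y ∈ s, y.index < i ∨ y = .b i h₁ h₂) ∧ (∃ y ∈ s', y.index < i ∨ y = .b i h₁ h₂)
  | .b i h₁ h₂ => (∃ y ∈ s, y.index < i ∨ y = .a i h₁ h₂) ∧ (∃ y ∈ s', y.index < i ∨ y = .a i h₁ h₂)
  | .x i h₁ h₂ => ∃ y ∈ s', y.index < i ∨ y = .a i h₁ h₂.le ∨ y = .b i h₁ h₂.le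

/-- Later phases only add labels, so a requirement once met stays met. The first child of an `x_i`
node may still be unlabelled. -/
theorem AllowedPartial.mono {l : PolyLabel k} {s s' r r' : Option (PolyLabel k)}
    (h : AllowedPartial l s s') (hs : ∀ y ∈ s, y ∈ r) (hs' : ∀ y ∈ s', y ∈ r') :
    AllowedPartial l r r' := by
  cases l with
  | a i h₁ h₂ =>
    exact ⟨h.1.imp fun y hy => ⟨hs y hy.1, hy.2⟩, h.2.imp fun y hy => ⟨hs' y hy.1, hy.2⟩⟩
  | b i h₁ h₂ =>
    exact ⟨h.1.imp fun y hy => ⟨hs y hy.1, hy.2⟩, h.2.imp fun y hy => ⟨hs' y hy.1, hy.2⟩⟩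
  | x i h₁ h₂ => exact Exists.imp (fun y hy => ⟨hs' y hy.1, hy.2⟩) h

theorem AllowedPartial.allowed {l s s' : PolyLabel k} (h : AllowedPartial l (some s) (some s')) :
    PolyLabel.Allowed l s s' := by
  cases l <;> simpa [AllowedPartial, PolyLabel.Allowed] using h

/-- A consistent partial solution with labels of index at most `q`. -/
def Consistent (t : FullTree 2) (D : t.Node → Option (PolyLabel k)) (q : ℕ) : Prop :=
  ∀ v, ∀ l ∈ D v, l.index ≤ q ∧ ∀ w : Fin 2 → t.Node, (∀ i, t.child? v i = some (w i)) →
    ∃ ρ : Equiv.Perm (Fin 2), AllowedPartial l (D (w (ρ 0))) (D (w (ρ 1)))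

theorem next_of_eq_some {τ q : ℕ} {v : t.Node} {l : PolyLabel k} (h : D v = some l) :
    next t D τ q v = some l := by
  simp [next, h]

theorem mem_next_of_mem {τ q : ℕ} {v : t.Node} : ∀ y ∈ D v, y ∈ next t D τ q v :=
  fun _ h => next_of_eq_some h

theorem next_of_small {τ q : ℕ} (hq : q + 1 ≤ k) {v : t.Node} {c : Bool} (h : D v = none)
    (hs : small t D τ v = true) (hc : color t D (small t D τ) (τ + 1) v = some c) :
    next t D τ q v = some (if c = true then .a (q + 1) q.succ_pos hq else .b (q + 1) q.succ_pos hq) := by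
  cases c <;> simp [next, h, pick, hq, hs, hc]

theorem Consistent.next {τ q : ℕ} (hD : Consistent t D q) (hq : q + 1 ≤ k) :
    Consistent t (next t D τ q) (q + 1) := by
  intro v l hl
  cases hv : D v with
  | some l' =>
    obtain rfl : l' = l := by simpa [Peeling.next, hv] using hl
    refine ⟨(hD v l' hv).1.trans q.le_succ, fun w hw => ?_⟩
    obtain ⟨ρ, hρ⟩ := (hD v l' hv).2 w hw
    exact ⟨ρ, hρ.mono mem_next_of_mem mem_next_of_mem⟩
  | none =>
    by_cases hs : small t D τ v = true
    · obtain ⟨c, hc⟩ := exists_color hv hs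
      have hcs : ∀ i w, t.child? v i = some w → ∃ y ∈ Peeling.next t D τ q w,
          y.index < q + 1 ∨
            y = if c = true then .b (q + 1) q.succ_pos hq else .a (q + 1) q.succ_pos hq := by
        intro i w hw
        cases hDw : D w with
        | some y => exact ⟨y, next_of_eq_some hDw, Or.inl (Nat.lt_succ_of_le (hD w y hDw).1)⟩
        | none =>
          -- Unfolding smallness within `τ + 1` rounds at `v` gives the children within `τ` rounds,
          -- the same bound as for `v`.
          have hw' : small t D τ w = true := by
            have := small_succ_eq_true.1 (small_mono_succ _ _ hs) i w hw
            simpa [hDw] using this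
          refine ⟨_, next_of_small (c := !c) hq hDw hw' ?_, Or.inr ?_⟩
          -- The parent has its colour after `τ` rounds and the child the opposite one a round
          -- later; this is why colouring takes `τ + 1` rounds.
          · rw [color_succ_of_child hw hv hs, hc]; rfl
          · cases c <;> simp
      have hlv := next_of_small hq hv hs (color_mono_succ _ _ _ hc)
      rw [hlv] at hl
      obtain rfl := Option.some.inj hl
      cases c
      · exact ⟨by simp [PolyLabel.index], fun w hw => ⟨1, hcs 0 _ (hw 0), hcs 1 _ (hw 1)⟩⟩
      · exact ⟨by simp [PolyLabel.index], fun w hw => ⟨1, hcs 0 _ (hw 0), hcs 1 _ (hw 1)⟩⟩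
    · rw [Peeling.next, hv, Option.none_or, pick, dif_pos hq, if_neg hs] at hl
      split_ifs at hl with h1 h2
      · rw [someDone_eq_true] at h2
        obtain ⟨i, u, hu, h2⟩ := h2
        obtain rfl := Option.some.inj hl
        -- The swap puts the labelled or small child in the second, constrained position of
        -- `x_{q+1}`.
        refine ⟨by simp [PolyLabel.index], fun w hw => ⟨Equiv.swap 1 i, ?_⟩⟩
        obtain rfl : w i = u := Option.some.inj ((hw i).symm.trans hu)
        simp only [AllowedPartial, Equiv.swap_apply_left]
        cases hDw : D (w i) with
        | some y => exact ⟨y, next_of_eq_some hDw, Or.inl (Nat.lt_succ_of_le (hD _ y hDw).1)⟩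
        | none =>
          have hsm : small t D τ (w i) = true := by simpa [hDw] using h2
          obtain ⟨c, hc⟩ := exists_color hDw hsm
          refine ⟨_, next_of_small hq hDw hsm (color_mono_succ _ _ _ hc), Or.inr ?_⟩
          cases c <;> simp
      · simp at hl
      · simp at hl

theorem consistent_labels (t : FullTree 2) (τ q : ℕ) (hq : q ≤ k) :
    Consistent t (labels k t τ q) q := by
  induction q with
  | zero => intro v l hl; simp [labels] at hl
  | succ q ih => exact (ih (by omega)).next hq

theorem Consistent.isSolution {q : ℕ} (hD : Consistent t D q) {lab : t.Node → PolyLabel k}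
    (h : ∀ v, D v = some (lab v)) : (polyProblem k).IsSolution t lab := by
  have key : ∀ (v : t.Node) (w : Fin 2 → t.Node), (∀ i, t.child? v i = some (w i)) →
      ∃ ρ : Equiv.Perm (Fin 2), PolyLabel.Allowed (lab v) (lab (w (ρ 0))) (lab (w (ρ 1))) := by
    intro v w hw
    obtain ⟨ρ, hρ⟩ := (hD v _ (h v)).2 w hw
    rw [h, h] at hρ
    exact ⟨ρ, hρ.allowed⟩
  exact key

end Semantics

end Peeling

namespace Peeling

open FullTree

variable {k : ℕ}

/-! ### Each phase divides the number of unlabelled nodes by `τ`. -/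

section Counting

variable {t : FullTree 2} {D : t.Node → Option (PolyLabel k)}

theorem of_next_eq_none {τ q : ℕ} (hq : q + 1 < k) {v : t.Node} (h : next t D τ q v = none) :
    D v = none ∧ small t D τ v = false ∧
      ∀ i w, t.child? v i = some w → D w = none ∧ small t D τ w = false := by
  rw [next, Option.or_eq_none_iff, pick, dif_pos hq.le, dif_pos hq] at h
  obtain ⟨h1, h2⟩ := h
  by_cases hs : small t D τ v = true
  · rw [if_pos hs] at h2
    split_ifs at h2
  · rw [if_neg hs] at h2
    split_ifs at h2 with h3
    refine ⟨h1, by simpa using hs, fun i w hw => ?_⟩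
    rw [someDone_eq_true] at h3
    push Not at h3
    simpa using h3 i w hw

theorem sum_children_le (f : t.Node → ℕ) :
    ∑ v, ∑ i, (t.child? v i).elim 0 f ≤ ∑ v, f v := by
  classical
  have h : ∀ (v : t.Node) (i : Fin 2),
      (t.child? v i).elim 0 f = ∑ w, if t.child? v i = some w then f w else 0 := by
    intro v i
    cases t.child? v i <;> simp
  simp_rw [h]
  rw [← Finset.sum_product', Finset.sum_comm]
  refine Finset.sum_le_sum fun w _ => ?_
  rw [← Finset.sum_filter, Finset.sum_const, smul_eq_mul]
  refine (Nat.mul_le_mul_right _ (Finset.card_le_one.2 ?_)).trans (one_mul _).le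
  intro p hp p' hp'
  simp only [Finset.mem_filter] at hp hp'
  exact Prod.ext_iff.2 (child?_injective hp.2 hp'.2)

variable (D)

/-- Indicator of an unlabelled node that is not known to be small after `s` rounds. -/
def big (s : ℕ) (v : t.Node) : ℕ := if D v = none ∧ small t D s v = false then 1 else 0

variable {D}

theorem big_succ_le (s : ℕ) (v : t.Node) :
    big D (s + 1) v ≤ ∑ i, (t.child? v i).elim 0 (big D s) := by
  rw [big]
  split_ifs with h
  · obtain ⟨-, h⟩ := h
    rw [← Bool.not_eq_true, small_succ_eq_true] at h
    push Not at h
    obtain ⟨i, w, hw, h⟩ := h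
    refine le_trans ?_ (Finset.single_le_sum (fun _ _ => Nat.zero_le _) (Finset.mem_univ i))
    have : D w = none ∧ small t D s w = false := by simpa using h
    simp [hw, big, this]
  · exact Nat.zero_le _

/-- The sum of `big D s v` over `s < τ` is the number of nodes on a longest downward unlabelled path
from `v`, capped at `τ`. Such a path continues in one of the children, so the sum of their values
plus one dominates. -/
theorem sum_big_le (τ : ℕ) (v : t.Node) :
    ∑ s ∈ Finset.range τ, big D s v ≤
      (if D v = none then 1 else 0) +
        ∑ i, (t.child? v i).elim 0 fun w => ∑ s ∈ Finset.range τ, big D s w := by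
  cases τ with
  | zero => simp
  | succ τ =>
    rw [Finset.sum_range_succ', add_comm]
    refine Nat.add_le_add ?_ ?_
    · rw [big]
      split_ifs <;> simp_all
    · refine (Finset.sum_le_sum fun s _ => big_succ_le s v).trans ?_
      rw [Finset.sum_comm]
      refine Finset.sum_le_sum fun i _ => ?_
      cases t.child? v i with
      | none => simp
      | some w => simp [Finset.sum_range_succ]

/-- A survivor and both its children have the full potential `τ`, so there the inequality has slack
`τ`: one child pays for the potential of `v`, the other for the extra term. -/
theorem sum_big_add_le {τ q : ℕ} (hq : q + 1 < k) (v : t.Node) :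
    ∑ s ∈ Finset.range τ, big D s v + (if next t D τ q v = none then 1 else 0) * τ ≤
      (if D v = none then 1 else 0) +
        ∑ i, (t.child? v i).elim 0 fun w => ∑ s ∈ Finset.range τ, big D s w := by
  by_cases h : next t D τ q v = none
  · rw [if_pos h, one_mul]
    obtain ⟨h1, h2, h3⟩ := of_next_eq_none hq h
    cases τ with
    | zero => simp
    | succ τ =>
      rw [← Bool.not_eq_true, small_succ_eq_true] at h2
      push Not at h2
      obtain ⟨j, u, hu, -⟩ := h2
      have hsum : ∀ w, D w = none ∧ small t D (τ + 1) w = false →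
          ∑ s ∈ Finset.range (τ + 1), big D s w = τ + 1 := by
        intro w hw
        rw [Finset.sum_congr rfl (g := fun _ => 1), Finset.sum_const, Finset.card_range,
          smul_eq_mul, mul_one]
        intro s hs
        rw [big, if_pos]
        refine ⟨hw.1, ?_⟩
        rw [← Bool.not_eq_true]
        intro hs'
        have := small_mono (Finset.mem_range.1 hs).le hs'
        simp [hw.2] at this
      have hv := hsum v ⟨h1, (of_next_eq_none hq h).2.1⟩
      obtain ⟨w0, hw0⟩ := exists_child_of_child hu 0
      obtain ⟨w1, hw1⟩ := exists_child_of_child hu 1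
      rw [hv, Fin.sum_univ_two, hw0, hw1, Option.elim_some, Option.elim_some,
        hsum _ (h3 0 w0 hw0), hsum _ (h3 1 w1 hw1), if_pos h1]
      omega
  · rw [if_neg h, zero_mul, add_zero]
    exact sum_big_le τ v

theorem card_next_mul_le {τ q : ℕ} (hq : q + 1 < k) :
    (Finset.univ.filter fun v => next t D τ q v = none).card * τ ≤
      (Finset.univ.filter fun v => D v = none).card := by
  have h := Finset.sum_le_sum fun v (_ : v ∈ Finset.univ) => sum_big_add_le (D := D) (τ := τ) hq v
  rw [Finset.sum_add_distrib, Finset.sum_add_distrib, ← Finset.sum_mul] at h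
  have h' := sum_children_le (t := t) fun w => ∑ s ∈ Finset.range τ, big D s w
  simp only [Finset.card_filter]
  -- Every node is a child at most once, so the potentials on the right are bounded by those on the
  -- left and cancel.
  omega

/-- A node that is not small has an unlabelled child that is not small within one round fewer.
Counting only nodes at least as deep as `v` makes `v` itself new in each step. -/
theorem succ_le_card_of_not_small (s : ℕ) :
    ∀ v, D v = none → small t D s v = false →
      s + 1 ≤ (Finset.univ.filter fun w => D w = none ∧ v.1.length ≤ w.1.length).card := by
  induction s with
  | zero =>
    intro v hv _
    exact Finset.card_pos.2 ⟨v, by simp [hv]⟩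
  | succ s ih =>
    intro v hv hs
    rw [← Bool.not_eq_true, small_succ_eq_true] at hs
    push Not at hs
    obtain ⟨i, w, hw, h⟩ := hs
    have h' : D w = none ∧ small t D s w = false := by simpa using h
    refine (Nat.succ_le_succ (ih w h'.1 h'.2)).trans (Finset.card_lt_card ?_)
    have hlen : w.1.length = v.1.length + 1 := by rw [child?_eq_some.1 hw]; rfl
    rw [Finset.ssubset_iff_of_subset]
    · exact ⟨v, by simp [hv], by simp [hlen]⟩
    · intro u hu
      simp only [Finset.mem_filter, Finset.mem_univ, true_and] at hu ⊢
      exact ⟨hu.1, by omega⟩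

theorem card_labels_mul_le (t : FullTree 2) (τ : ℕ) {q : ℕ} (hq : q < k) :
    (Finset.univ.filter fun v => labels k t τ q v = none).card * τ ^ q ≤ t.size := by
  induction q with
  | zero =>
    rw [pow_zero, mul_one]
    refine (Finset.card_filter_le _ _).trans ?_
    simp [FullTree.size]
  | succ q ih =>
    refine le_trans ?_ (ih (by omega))
    rw [pow_succ', ← mul_assoc]
    exact Nat.mul_le_mul_right _ (card_next_mul_le hq)

theorem labels_ne_none (hk : 1 ≤ k) (t : FullTree 2) {τ : ℕ} (hτ : t.size ≤ τ ^ k) (v : t.Node) :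
    labels k t τ k v ≠ none := by
  obtain ⟨q, rfl⟩ : ∃ q, k = q + 1 := ⟨k - 1, by omega⟩
  have hpos : 0 < t.size := Finset.card_pos.2 ⟨[], t.nil_mem_nodes⟩
  have hτ0 : 0 < τ := Nat.pos_of_ne_zero fun h => by simp [h] at hτ; omega
  intro hv
  rw [labels, next, Option.or_eq_none_iff, pick, dif_pos le_rfl] at hv
  obtain ⟨hv, hp⟩ := hv
  have hcard := card_labels_mul_le t τ (Nat.lt_succ_self q)
  -- The last phase has no label `x`, so every remaining node must be small; at most `τ` of them are
  -- left, too few for a path of `τ + 1`.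
  have hle : (Finset.univ.filter fun v => labels (q + 1) t τ q v = none).card ≤ τ := by
    refine Nat.le_of_mul_le_mul_right (c := τ ^ q) ?_ (pow_pos hτ0 q)
    rw [← pow_succ']
    exact hcard.trans hτ
  by_cases hs : small t (labels (q + 1) t τ q) τ v = true
  · rw [if_pos hs] at hp
    split_ifs at hp
  · have := succ_le_card_of_not_small τ v hv (by simpa using hs)
    have h2 := Finset.card_le_card (Finset.monotone_filter_right (Finset.univ : Finset t.Node)
      (p := fun w => labels (q + 1) t τ q w = none ∧ v.1.length ≤ w.1.length)
      (q := fun w => labels (q + 1) t τ q w = none) fun w _ h => h.1)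
    omega

end Counting

/-! ### The message-passing algorithm carries out the phases. -/

section Simulation

/-- One round of the algorithm: in each phase of `2 * τ + 2` rounds, `τ` rounds find the small
nodes, `τ + 1` rounds colour them, and the last round assigns labels. -/
def step (τ r : ℕ) (own : Flags k) (par : Option (Flags k)) (ch : Fin 2 → Option (Flags k)) :
    Flags k :=
  if r % (2 * τ + 2) < τ then
    (own.1, allDone fun i => (ch i).map fun m => (m.1, m.2.1), own.2.2)
  else if r % (2 * τ + 2) < 2 * τ + 1 then
    (own.1, own.2.1, colorFrom par)
  else
    (own.1.or (pick (r / (2 * τ + 2)) own.2.1 own.2.2 fun i => (ch i).map fun m => (m.1, m.2.1)),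
      false, none)

/-- The algorithm with `τ n` as bound for the height of small components. -/
def algorithm (hk : 1 ≤ k) (τ : ℕ → ℕ) : Algorithm 2 (PolyLabel k) where
  State := ℕ × ℕ × Flags k
  Msg := Flags k
  init n _ _ _ _ := (n, 0, none, false, none)
  toParent s := s.2.2
  toChild s _ := s.2.2
  update s par ch := (s.1, s.2.1 + 1, step (τ s.1) s.2.1 s.2.2 par ch)
  output s := s.2.2.1.getD (.a 1 le_rfl hk)

variable (hk : 1 ≤ k) (τ : ℕ → ℕ) {t : FullTree 2} (ident : t.Node → ℕ) (ω : t.Node → ℕ → Bool)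

theorem run_succ {r : ℕ} {F : t.Node → Flags k}
    (h : ∀ v, (algorithm hk τ).run t ident ω r v = (t.size, r, F v)) (v : t.Node) :
    (algorithm hk τ).run t ident ω (r + 1) v =
      (t.size, r + 1, step (τ t.size) r (F v) ((t.parent? v).map fun u => F u.1)
        fun i => (t.child? v i).map F) := by
  have h' : (algorithm hk τ).run t ident ω r = fun v => (t.size, r, F v) := funext h
  rw [Algorithm.run, h']
  rfl

theorem run_small {r q : ℕ} {D : t.Node → Option (PolyLabel k)}
    (hr : r = q * (2 * τ t.size + 2))
    (h : ∀ v, (algorithm hk τ).run t ident ω r v = (t.size, r, D v, false, none))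
    {s : ℕ} (hs : s ≤ τ t.size) :
    ∀ v, (algorithm hk τ).run t ident ω (r + s) v = (t.size, r + s, D v, small t D s v, none) := by
  induction s with
  | zero => exact h
  | succ s ih =>
    intro v
    rw [← add_assoc, run_succ hk τ ident ω (ih (by omega)) v]
    have : (r + s) % (2 * τ t.size + 2) = s := by
      rw [hr, Nat.mul_add_mod_self_right, Nat.mod_eq_of_lt (by omega)]
    rw [step, this, if_pos (by omega)]
    simp only [Option.map_map, Function.comp_def]
    rfl

theorem run_color {r q : ℕ} {D : t.Node → Option (PolyLabel k)}
    (hr : r = q * (2 * τ t.size + 2))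
    (h : ∀ v, (algorithm hk τ).run t ident ω r v = (t.size, r, D v, false, none))
    {s : ℕ} (hs : s ≤ τ t.size + 1) :
    ∀ v, (algorithm hk τ).run t ident ω (r + τ t.size + s) v =
      (t.size, r + τ t.size + s, D v, small t D (τ t.size) v,
        color t D (small t D (τ t.size)) s v) := by
  induction s with
  | zero => exact run_small hk τ ident ω hr h le_rfl
  | succ s ih =>
    intro v
    rw [← add_assoc, run_succ hk τ ident ω (ih (by omega)) v]
    have : (r + τ t.size + s) % (2 * τ t.size + 2) = τ t.size + s := by
      rw [hr, add_assoc, Nat.mul_add_mod_self_right, Nat.mod_eq_of_lt (by omega)]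
    rw [step, this, if_neg (by omega), if_pos (by omega)]
    rfl

theorem run_phase (q : ℕ) : ∀ v,
    (algorithm hk τ).run t ident ω (q * (2 * τ t.size + 2)) v =
      (t.size, q * (2 * τ t.size + 2), labels k t (τ t.size) q v, false, none) := by
  induction q with
  | zero =>
    intro v
    simp [Algorithm.run, algorithm, labels]
  | succ q ih =>
    intro v
    have hr : (q + 1) * (2 * τ t.size + 2) =
      q * (2 * τ t.size + 2) + τ t.size + (τ t.size + 1) + 1 := by ring
    rw [hr, run_succ hk τ ident ω (run_color hk τ ident ω rfl ih le_rfl) v]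
    have h1 : q * (2 * τ t.size + 2) + τ t.size + (τ t.size + 1) =
      q * (2 * τ t.size + 2) + (2 * τ t.size + 1) := by ring
    have h2 : (q * (2 * τ t.size + 2) + (2 * τ t.size + 1)) % (2 * τ t.size + 2) =
        2 * τ t.size + 1 := by
      rw [Nat.mul_add_mod_self_right, Nat.mod_eq_of_lt (by omega)]
    have h3 : (q * (2 * τ t.size + 2) + (2 * τ t.size + 1)) / (2 * τ t.size + 2) = q := by
      rw [mul_comm, Nat.mul_add_div (by omega), Nat.div_eq_of_lt (by omega), add_zero]
    rw [h1, step, h2, h3, if_neg (by omega), if_neg (by omega)]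
    simp only [Option.map_map, Function.comp_def]
    rfl

end Simulation

/-- The number of rounds of a phase is governed by `⌈n ^ (1 / k)⌉`. -/
noncomputable def threshold (k n : ℕ) : ℕ := ⌈(n : ℝ) ^ (1 / (k : ℝ))⌉₊

theorem le_threshold_pow (hk : 1 ≤ k) (n : ℕ) : n ≤ threshold k n ^ k := by
  have h : (n : ℝ) ≤ (threshold k n : ℝ) ^ k := by
    calc (n : ℝ) = ((n : ℝ) ^ (1 / (k : ℝ))) ^ k := by
          rw [one_div, Real.rpow_inv_natCast_pow n.cast_nonneg (by omega)]
      _ ≤ _ := pow_le_pow_left₀ (by positivity) (Nat.le_ceil _) k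
  exact_mod_cast h

theorem isSolution_result (hk : 1 ≤ k) (t : FullTree 2) (ident : t.Node → ℕ)
    (ω : t.Node → ℕ → Bool) :
    (polyProblem k).IsSolution t ((algorithm hk (threshold k)).result t ident ω
      (k * (2 * threshold k t.size + 2))) := by
  refine (consistent_labels (k := k) t (threshold k t.size) k le_rfl).isSolution fun v => ?_
  obtain ⟨l, hl⟩ := Option.ne_none_iff_exists'.1
    (labels_ne_none hk t (le_threshold_pow hk t.size) v)
  rw [Algorithm.result, run_phase]
  simp [algorithm, hl]

/-- The message type is finite and does not depend on `n`, so even a unary code has bounded length.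
-/
theorem hasSmallMessages (hk : 1 ≤ k) (τ : ℕ → ℕ) (c : ℕ) (T : ℕ → ℕ) :
    HasSmallMessages c (algorithm hk τ) T := by
  have := PolyLabel.finite k
  obtain ⟨N, ⟨e⟩⟩ := Finite.exists_equiv_fin (Flags k)
  have hlen : ∀ (x : Flags k) (n : ℕ),
      (List.replicate (e x) true).length ≤ N * (Nat.log 2 n + 1) := by
    intro x n
    rw [List.length_replicate]
    exact (e x).2.le.trans (Nat.le_mul_of_pos_right _ (Nat.succ_pos _))
  refine ⟨fun x => List.replicate (e x) true, fun x y h => ?_, N, fun t ident _ ω r _ v =>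
    ⟨hlen _ _, fun i => hlen _ _⟩⟩
  have := congrArg List.length h
  simp only [List.length_replicate] at this
  exact e.injective (Fin.ext this)

theorem solves_deterministic (hk : 1 ≤ k) (c : ℕ) :
    Solves .CONGEST .deterministic c (polyProblem k) (algorithm hk (threshold k))
      fun n => k * (2 * threshold k n + 2) :=
  ⟨hasSmallMessages hk _ c _, fun _ _ _ _ _ _ => rfl,
    fun t ident _ ω => isSolution_result hk t ident ω⟩

theorem rounds_le (k : ℕ) {n : ℕ} (hn : 1 ≤ n) :
    ((k * (2 * threshold k n + 2) : ℕ) : ℝ) ≤ 6 * k * (n : ℝ) ^ (1 / (k : ℝ)) := by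
  have h1 : (1 : ℝ) ≤ (n : ℝ) ^ (1 / (k : ℝ)) :=
    Real.one_le_rpow (by exact_mod_cast hn) (by positivity)
  have h2 : (threshold k n : ℝ) < (n : ℝ) ^ (1 / (k : ℝ)) + 1 :=
    Nat.ceil_lt_add_one (by positivity)
  push_cast
  have : (2 * (threshold k n : ℝ) + 2) ≤ 6 * (n : ℝ) ^ (1 / (k : ℝ)) := by linarith
  calc (k : ℝ) * (2 * (threshold k n : ℝ) + 2) ≤ k * (6 * (n : ℝ) ^ (1 / (k : ℝ))) := by gcongr
    _ = _ := by ring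

end Peeling

/-- A deterministic algorithm with short messages works in all models. -/
theorem Solves.of_deterministic_congest {c : ℕ} {P : LCL} {A : Algorithm P.δ P.Label} {T : ℕ → ℕ}
    (h : Solves .CONGEST .deterministic c P A T) (b : Bandwidth) (ρ : Randomness) :
    Solves b ρ c P A T := by
  obtain ⟨h1, h2, h3⟩ := h
  refine ⟨?_, ?_⟩
  · cases b
    · trivial
    · exact h1
  · cases ρ
    · exact ⟨h2, h3⟩
    · intro t ident hid
      have : {ω | ¬ P.IsSolution t (A.result t ident ω (T t.size))} = ∅ := by
        ext ω; simp [h3 t ident hid ω]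
      rw [this]; simp

/-- Every solution is in particular a randomized algorithm with unbounded messages. -/
theorem Solves.randomized_local {c : ℕ} {P : LCL} {A : Algorithm P.δ P.Label} {T : ℕ → ℕ}
    {b : Bandwidth} {ρ : Randomness} (h : Solves b ρ c P A T) :
    Solves .LOCAL .randomized c P A T := by
  obtain ⟨-, h⟩ := h
  refine ⟨trivial, ?_⟩
  cases ρ
  · intro t ident hid
    have : {ω | ¬ P.IsSolution t (A.result t ident ω (T t.size))} = ∅ := by
      ext ω; simp [h.2 t ident hid ω]
    rw [this]; simp
  · exact h

/-! ### Nested spines, and addresses along a path. -/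

namespace FullTree

theorem size_node {δ : ℕ} (c : Fin δ → FullTree δ) : (node c).size = 1 + ∑ i, (c i).size := by
  rw [size, nodes, Finset.card_insert_of_notMem (by simp), Finset.card_biUnion, add_comm]
  · congr 1
    refine Finset.sum_congr rfl fun i _ => ?_
    exact Finset.card_image_of_injective _ (List.append_left_injective [i])
  · intro i _ j _ hij
    rw [Function.onFun, Finset.disjoint_left]
    intro p hp hp'
    simp only [Finset.mem_image] at hp hp'
    obtain ⟨q, -, rfl⟩ := hp
    obtain ⟨q', -, h⟩ := hp'
    have := (List.append_inj' h rfl).2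
    simp at this
    exact hij this.symm

theorem odd_size (t : FullTree 2) : Odd t.size := by
  induction t with
  | leaf => simp [size, nodes]
  | node c ih =>
    rw [size_node, Fin.sum_univ_two, add_comm]
    exact ((ih 0).add_odd (ih 1)).add_one

/-- A path of `L` nodes with a copy of `H` hanging off each of them, ending in `D`. -/
def spine (H D : FullTree 2) : ℕ → FullTree 2
  | 0 => D
  | L + 1 => node ![spine H D L, H]

theorem size_spine (H D : FullTree 2) (L : ℕ) :
    (spine H D L).size = L * (1 + H.size) + D.size := by
  induction L with
  | zero => simp [spine]
  | succ L ih =>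
    rw [spine, size_node, Fin.sum_univ_two]
    simp [ih]
    ring

theorem size_leaf {δ : ℕ} : (leaf : FullTree δ).size = 1 := by simp [size, nodes]

theorem exists_size_eq {n : ℕ} (hn : Odd n) : ∃ t : FullTree 2, t.size = n := by
  obtain ⟨m, rfl⟩ := hn
  exact ⟨spine leaf leaf m, by rw [size_spine, size_leaf]; ring⟩

/-- Nested spines of length `L`. -/
def nested (L : ℕ) : ℕ → FullTree 2
  | 0 => leaf
  | i + 1 => spine (nested L i) leaf L

theorem size_nested_le (L i : ℕ) : (nested L i).size ≤ (2 * L + 1) ^ i := by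
  induction i with
  | zero => simp [nested, size_leaf]
  | succ i ih =>
    have h1 : 1 ≤ (2 * L + 1) ^ i := Nat.one_le_pow _ _ (by omega)
    rw [nested, size_spine, size_leaf, pow_succ]
    nlinarith [Nat.mul_le_mul_left L ih, Nat.mul_le_mul_left L h1]

/-- There is a tree of size `n` that begins with `L` nodes with nested spines hanging off them. -/
theorem exists_spine_nested_size_eq {L i n : ℕ} (hn : Odd n) (h : (2 * L + 1) ^ (i + 1) ≤ n) :
    ∃ D : FullTree 2, (spine (nested L i) D L).size = n := by
  have h1 : 1 ≤ (2 * L + 1) ^ i := Nat.one_le_pow _ _ (by omega)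
  have h2 : L * (1 + (nested L i).size) + 1 ≤ n := by
    refine le_trans ?_ h
    rw [pow_succ]
    nlinarith [Nat.mul_le_mul_left L (size_nested_le L i), Nat.mul_le_mul_left L h1]
  have h3 : Even (L * (1 + (nested L i).size)) := by
    refine Even.mul_left ?_ L
    rw [add_comm]
    exact (odd_size _).add_one
  obtain ⟨D, hD⟩ := exists_size_eq (n := n - L * (1 + (nested L i).size))
    (Nat.Odd.sub_even (by omega) hn h3)
  exact ⟨D, by rw [size_spine, hD]; omega⟩

/-- The subtree of `t` below the address `v` is `s`. -/
def SubtreeAt {δ : ℕ} (t : FullTree δ) (v : List (Fin δ)) (s : FullTree δ) : Prop :=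
  ∀ q, q ++ v ∈ t.nodes ↔ q ∈ s.nodes

theorem subtreeAt_nil {δ : ℕ} (t : FullTree δ) : t.SubtreeAt [] t := fun q => by simp

theorem SubtreeAt.mem {δ : ℕ} {t s : FullTree δ} {v : List (Fin δ)} (h : t.SubtreeAt v s) :
    v ∈ t.nodes := (h []).2 s.nil_mem_nodes

theorem SubtreeAt.child {δ : ℕ} {t : FullTree δ} {v : List (Fin δ)} {c : Fin δ → FullTree δ}
    (h : t.SubtreeAt v (node c)) (i : Fin δ) : t.SubtreeAt (i :: v) (c i) := by
  intro q
  rw [← concat_mem_nodes_node, ← h, List.append_assoc, List.singleton_append]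

/-- The address of the `j`-th node of the path that starts at `v` and uses only `0`-th children. -/
def pathAddr (v : List (Fin 2)) (j : ℕ) : List (Fin 2) := List.replicate j 0 ++ v

theorem pathAddr_succ (v : List (Fin 2)) (j : ℕ) : pathAddr v (j + 1) = 0 :: pathAddr v j := rfl

theorem length_pathAddr (v : List (Fin 2)) (j : ℕ) : (pathAddr v j).length = j + v.length := by
  simp [pathAddr]

theorem pathAddr_add (v : List (Fin 2)) (i j : ℕ) :
    pathAddr v (i + j) = List.replicate i 0 ++ pathAddr v j := by
  rw [pathAddr, List.replicate_add, List.append_assoc, pathAddr]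

theorem pathAddr_suffix (v : List (Fin 2)) {i j : ℕ} (h : i ≤ j) : pathAddr v i <:+ pathAddr v j := by
  obtain ⟨d, rfl⟩ := Nat.exists_eq_add_of_le' h
  rw [pathAddr_add]
  exact List.suffix_append _ _

theorem pathAddr_not_suffix (v : List (Fin 2)) {i j : ℕ} (h : i < j) :
    ¬ pathAddr v j <:+ pathAddr v i := by
  intro h'
  have := h'.length_le
  simp only [length_pathAddr] at this
  omega

theorem pathAddr_suffix_of_cons {v w : List (Fin 2)} {j : ℕ} {i : Fin 2}
    (h : pathAddr v (j + 1) <:+ i :: w) : pathAddr v j <:+ w := by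
  rcases List.suffix_cons_iff.1 h with h | h
  · rw [pathAddr_succ, List.cons.injEq] at h
    rw [h.2]
  · exact (pathAddr_suffix v j.le_succ).trans h

/-- Since addresses list the last step first, `<:+` means "is an ancestor of or equal to". Two
spines look alike outside the subtree of their `d`-th path node. -/
theorem mem_nodes_spine_congr (H D : FullTree 2) (d : ℕ) :
    ∀ {N M : ℕ} {u : List (Fin 2)}, d ≤ N → d ≤ M → ¬ List.replicate d 0 <:+ u →
      (u ∈ (spine H D N).nodes ↔ u ∈ (spine H D M).nodes) := by
  induction d with
  | zero => intro N M u _ _ h; simp at h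
  | succ d ih =>
    intro N M u hN hM h
    obtain ⟨N, rfl⟩ := Nat.exists_eq_add_of_le' hN
    obtain ⟨M, rfl⟩ := Nat.exists_eq_add_of_le' hM
    rw [← add_assoc, ← add_assoc, spine, spine]
    rcases u.eq_nil_or_concat with rfl | ⟨q, l, rfl⟩
    · simp [nil_mem_nodes]
    · rw [List.concat_eq_append] at h ⊢
      rw [concat_mem_nodes_node, concat_mem_nodes_node]
      fin_cases l
      · refine ih (by omega) (by omega) fun h' => h ?_
        rw [List.replicate_succ']
        obtain ⟨r, rfl⟩ := h'
        exact ⟨r, by simp⟩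
      · rfl

/-! ### Shifting a segment of a spine by one step. -/

section Spine

variable {t H D : FullTree 2} {v : List (Fin 2)} {L : ℕ}

theorem SubtreeAt.pathAddr (h : t.SubtreeAt v (spine H D L)) {j : ℕ} (hj : j ≤ L) :
    t.SubtreeAt (pathAddr v j) (spine H D (L - j)) := by
  induction j with
  | zero => exact h
  | succ j ih =>
    have := ih (by omega)
    rw [show L - j = L - (j + 1) + 1 by omega, spine] at this
    exact this.child 0

theorem SubtreeAt.hanging (h : t.SubtreeAt v (spine H D L)) {j : ℕ} (hj : j < L) :
    t.SubtreeAt (1 :: FullTree.pathAddr v j) H := by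
  have := h.pathAddr hj.le
  rw [show L - j = L - (j + 1) + 1 by omega, spine] at this
  exact this.child 1

open Classical in
/-- Moves everything below the `l`-th node of a path one step down the path. -/
noncomputable def shift (v : List (Fin 2)) (l : ℕ) (w : List (Fin 2)) : List (Fin 2) :=
  if h : ∃ u, u ++ FullTree.pathAddr v l = w then h.choose ++ FullTree.pathAddr v (l + 1) else w

theorem shift_append (v u : List (Fin 2)) (l : ℕ) :
    shift v l (u ++ FullTree.pathAddr v l) = u ++ FullTree.pathAddr v (l + 1) := by
  have h : ∃ u', u' ++ FullTree.pathAddr v l = u ++ FullTree.pathAddr v l := ⟨u, rfl⟩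
  rw [shift, dif_pos h, List.append_cancel_right h.choose_spec]

theorem shift_of_not_suffix {w : List (Fin 2)} {l : ℕ} (h : ¬ FullTree.pathAddr v l <:+ w) :
    shift v l w = w := dif_neg h

theorem shift_cons_of_suffix {w : List (Fin 2)} {l : ℕ} (h : FullTree.pathAddr v l <:+ w)
    (i : Fin 2) : shift v l (i :: w) = i :: shift v l w := by
  obtain ⟨u, rfl⟩ := h
  rw [← List.cons_append, shift_append, shift_append, List.cons_append]

/-- The addresses whose surroundings of radius `r` look the same after shifting. -/
def Zone (v : List (Fin 2)) (T r : ℕ) (w : List (Fin 2)) : Prop :=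
  ¬ FullTree.pathAddr v (T + 1 - r) <:+ w ∨
    (FullTree.pathAddr v (T + 1 + r) <:+ w ∧ ¬ FullTree.pathAddr v (3 * T + 2 - r) <:+ w)

theorem Zone.zero {T r : ℕ} {w : List (Fin 2)} (h : Zone v T r w) : Zone v T 0 w := by
  refine h.imp (fun h h' => h ((pathAddr_suffix v ?_).trans h')) fun h =>
    ⟨(pathAddr_suffix v ?_).trans h.1, fun h' => h.2 ((pathAddr_suffix v ?_).trans h')⟩ <;> omega

theorem Zone.cons {T r : ℕ} (hr : r < T) {w : List (Fin 2)} (h : Zone v T (r + 1) w) (i : Fin 2) :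
    Zone v T r (i :: w) ∧ shift v (T + 1) (i :: w) = i :: shift v (T + 1) w := by
  rcases h with h | ⟨h, h'⟩
  · have h1 : ¬ FullTree.pathAddr v (T + 1 - r) <:+ i :: w := fun h1 => by
      rw [show T + 1 - r = T + 1 - (r + 1) + 1 by omega] at h1
      exact h (pathAddr_suffix_of_cons h1)
    refine ⟨Or.inl h1, ?_⟩
    have h2 : ¬ FullTree.pathAddr v (T + 1) <:+ i :: w := fun h2 =>
      h1 ((pathAddr_suffix v (by omega)).trans h2)
    rw [shift_of_not_suffix h2,
      shift_of_not_suffix fun h3 => h2 (h3.trans (List.suffix_cons i w))]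
  · refine ⟨Or.inr ⟨?_, fun h1 => ?_⟩, shift_cons_of_suffix ?_ i⟩
    · exact ((pathAddr_suffix v (by omega)).trans h).trans (List.suffix_cons i w)
    · rw [show 3 * T + 2 - r = 3 * T + 2 - (r + 1) + 1 by omega] at h1
      exact h' (pathAddr_suffix_of_cons h1)
    · exact (pathAddr_suffix v (by omega)).trans h

theorem Zone.of_cons {T r : ℕ} {w : List (Fin 2)} {i : Fin 2}
    (h : Zone v T (r + 1) (i :: w)) :
    Zone v T r w ∧ shift v (T + 1) (i :: w) = i :: shift v (T + 1) w := by
  rcases h with h | ⟨h, h'⟩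
  · have h1 : ¬ FullTree.pathAddr v (T + 1) <:+ i :: w := fun h1 =>
      h ((pathAddr_suffix v (by omega)).trans h1)
    refine ⟨Or.inl fun h2 => h ?_, ?_⟩
    · exact ((pathAddr_suffix v (by omega)).trans h2).trans (List.suffix_cons i w)
    · rw [shift_of_not_suffix h1,
        shift_of_not_suffix fun h3 => h1 (h3.trans (List.suffix_cons i w))]
  · have h1 : FullTree.pathAddr v (T + 1 + r) <:+ w := pathAddr_suffix_of_cons h
    refine ⟨Or.inr ⟨h1, fun h2 => h' ?_⟩, shift_cons_of_suffix ?_ i⟩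
    · exact ((pathAddr_suffix v (by omega)).trans h2).trans (List.suffix_cons i w)
    · exact (pathAddr_suffix v (by omega)).trans h1

theorem Zone.shift_eq_nil {T : ℕ} {w : List (Fin 2)} (h : Zone v T 0 w) :
    shift v (T + 1) w = [] ↔ w = [] := by
  rcases h with h | ⟨⟨u, rfl⟩, -⟩
  · rw [Nat.sub_zero] at h
    rw [shift_of_not_suffix h]
  · rw [add_zero, shift_append]
    simp [pathAddr_succ]

theorem Zone.shift_mem (ht : t.SubtreeAt v (spine H D L)) {T : ℕ} (hL : 3 * T + 4 ≤ L)
    {w : List (Fin 2)} (h : Zone v T 0 w) :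
    shift v (T + 1) w ∈ t.nodes ↔ w ∈ t.nodes := by
  rcases h with h | ⟨⟨u, rfl⟩, h⟩
  · rw [Nat.sub_zero] at h
    rw [shift_of_not_suffix h]
  · rw [add_zero] at h ⊢
    rw [shift_append, ht.pathAddr (by omega), ht.pathAddr (by omega)]
    refine mem_nodes_spine_congr H D (2 * T + 1) (by omega) (by omega) fun h' => h ?_
    rw [Nat.sub_zero, show 3 * T + 2 = 2 * T + 1 + (T + 1) by ring, pathAddr_add]
    obtain ⟨r, rfl⟩ := h'
    exact ⟨r, by simp⟩

theorem Zone.cons_shift_mem (ht : t.SubtreeAt v (spine H D L)) {T : ℕ} (hL : 3 * T + 4 ≤ L)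
    {w : List (Fin 2)} (h : Zone v T 0 w) (i : Fin 2) :
    i :: shift v (T + 1) w ∈ t.nodes ↔ i :: w ∈ t.nodes := by
  rcases h with h | ⟨⟨u, rfl⟩, h⟩
  · rw [Nat.sub_zero] at h
    rw [shift_of_not_suffix h]
  · rw [add_zero] at h ⊢
    rw [shift_append, ← List.cons_append, ← List.cons_append, ht.pathAddr (by omega),
      ht.pathAddr (by omega)]
    -- Looking at children costs one more level than in `Zone.shift_mem`: `2 * T + 2 ≤ L - (T + 2)`
    -- is where `3 * T + 4 ≤ L` is needed in full.
    refine mem_nodes_spine_congr H D (2 * T + 2) (by omega) (by omega) fun h' => h ?_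
    have h2 : FullTree.pathAddr v (3 * T + 2 + 1) <:+ i :: (u ++ FullTree.pathAddr v (T + 1)) := by
      rw [show 3 * T + 2 + 1 = 2 * T + 2 + (T + 1) by ring, pathAddr_add, ← List.cons_append]
      obtain ⟨r, hr⟩ := h'
      exact ⟨r, by rw [← hr]; simp⟩
    exact pathAddr_suffix_of_cons h2

/-- The shift is prescribed only above the path node `3 * T + 2`, where it is injective and stays in
the tree. By finiteness it extends to a permutation; what this does to the remaining nodes is
irrelevant. -/
theorem exists_equiv_shift (ht : t.SubtreeAt v (spine H D L)) {T : ℕ} (hL : 3 * T + 4 ≤ L) :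
    ∃ g : t.Node ≃ t.Node, ∀ w : t.Node, Zone v T 0 w.1 → (g w).1 = shift v (T + 1) w.1 := by
  refine Set.MapsTo.exists_equiv_extend_of_card_eq (t := t.nodes) (Fintype.card_coe _)
    (s := {w : t.Node | Zone v T 0 w.1}) (f := fun w => shift v (T + 1) w.1) ?_ ?_
  · intro w hw
    exact (Zone.shift_mem ht hL hw).2 w.2
  · have key : ∀ w w' : List (Fin 2), ¬ FullTree.pathAddr v (T + 1) <:+ w →
        FullTree.pathAddr v (T + 1) <:+ w' → shift v (T + 1) w ≠ shift v (T + 1) w' := by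
      rintro w _ hw ⟨u, rfl⟩ h
      rw [shift_of_not_suffix hw, shift_append] at h
      exact hw (h ▸ (pathAddr_suffix v (Nat.le_succ _)).trans (List.suffix_append _ _))
    rintro ⟨w, hw⟩ h ⟨w', hw'⟩ h' he
    refine Subtype.ext ?_
    change shift v (T + 1) w = shift v (T + 1) w' at he
    change w = w'
    by_cases h1 : FullTree.pathAddr v (T + 1) <:+ w <;>
      by_cases h2 : FullTree.pathAddr v (T + 1) <:+ w'
    · obtain ⟨u, rfl⟩ := h1
      obtain ⟨u', rfl⟩ := h2
      rw [shift_append, shift_append] at he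
      rw [List.append_cancel_right he]
    · exact absurd he.symm (key _ _ h2 h1)
    · exact absurd he (key _ _ h1 h2)
    · rwa [shift_of_not_suffix h1, shift_of_not_suffix h2] at he

end Spine

end FullTree

/-! ### Locality: equal views give equal states. -/

namespace Algorithm

open FullTree

/-- After `r` rounds the state of a node depends only on its neighbourhood of radius `r`. -/
theorem run_congr {δ : ℕ} {L : Type} (A : Algorithm δ L) {t : FullTree δ} (g : t.Node → t.Node)
    {ident ident' : t.Node → ℕ} {ω ω' : t.Node → ℕ → Bool} (hid : ∀ v, ident' (g v) = ident v)
    (hω : ∀ v, ω' (g v) = ω v) (Z : ℕ → t.Node → Prop)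
    (h0 : ∀ r v, Z r v → (t.parent? (g v) = none ↔ t.parent? v = none) ∧
      ∀ i, t.child? (g v) i = none ↔ t.child? v i = none)
    (hZ : ∀ r v, Z (r + 1) v → Z r v)
    (hparent : ∀ r v u i, Z (r + 1) v → t.parent? v = some (u, i) →
      Z r u ∧ t.parent? (g v) = some (g u, i))
    (hchild : ∀ r v u i, Z (r + 1) v → t.child? v i = some u →
      Z r u ∧ t.child? (g v) i = some (g u)) (r : ℕ) :
    ∀ v, Z r v → A.run t ident' ω' r (g v) = A.run t ident ω r v := by
  induction r with
  | zero =>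
    intro v hv
    obtain ⟨h1, h2⟩ := h0 0 v hv
    have h1' : (t.parent? (g v)).isSome = (t.parent? v).isSome := by
      rw [Bool.eq_iff_iff, Option.isSome_iff_ne_none, Option.isSome_iff_ne_none, Ne, h1]
    have h2' : ∀ i, (t.child? (g v) i).isSome = (t.child? v i).isSome := fun i => by
      rw [Bool.eq_iff_iff, Option.isSome_iff_ne_none, Option.isSome_iff_ne_none, Ne, h2]
    simp only [run, hid, hω, h1', h2']
  | succ r ih =>
    intro v hv
    obtain ⟨h1, h2⟩ := h0 _ v hv
    simp only [run]
    congr 1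
    · exact ih v (hZ r v hv)
    · rcases hp : t.parent? v with _ | ⟨u, i⟩
      · rw [h1.2 hp]; rfl
      · obtain ⟨hu, hg⟩ := hparent r v u i hv hp
        simp [hg, ih u hu]
    · funext i
      rcases hp : t.child? v i with _ | u
      · rw [(h2 i).2 hp]; rfl
      · obtain ⟨hu, hg⟩ := hchild r v u i hv hp
        simp [hg, ih u hu]

/-- The zones shrink by one step per round. At radius `T` they still contain `v`, and the path node
`2 * T + 1`, which is halfway between the two ends of the shifted segment. -/
theorem run_shift {L' : Type} (A : Algorithm 2 L') {t H D : FullTree 2} {v : List (Fin 2)} {L : ℕ}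
    (ht : t.SubtreeAt v (spine H D L)) {T : ℕ} (hL : 3 * T + 4 ≤ L) {g : t.Node ≃ t.Node}
    (hg : ∀ w : t.Node, Zone v T 0 w.1 → (g w).1 = shift v (T + 1) w.1)
    (ident : t.Node → ℕ) (ω : t.Node → ℕ → Bool) {w : t.Node} (hw : Zone v T T w.1) :
    A.run t (ident ∘ g.symm) (ω ∘ g.symm) T (g w) = A.run t ident ω T w := by
  refine run_congr A g (by simp) (by simp) (fun r w => r ≤ T ∧ Zone v T r w.1) ?_ ?_ ?_ ?_ T w
    ⟨le_rfl, hw⟩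
  · rintro r w ⟨-, h⟩
    refine ⟨?_, fun i => ?_⟩
    · rw [parent?_eq_none, parent?_eq_none, hg w h.zero, h.zero.shift_eq_nil]
    · rw [child?_eq_none, child?_eq_none, hg w h.zero, h.zero.cons_shift_mem ht hL i]
  · rintro r w ⟨hr, h⟩
    refine ⟨by omega, h.imp (fun h h' => h ((pathAddr_suffix v ?_).trans h')) fun h =>
      ⟨(pathAddr_suffix v ?_).trans h.1, fun h' => h.2 ((pathAddr_suffix v ?_).trans h')⟩⟩ <;>
      omega
  · rintro r w u i ⟨hr, h⟩ hu
    rw [parent?_eq_some] at hu ⊢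
    have hgw := hg w h.zero
    rw [hu] at h hgw
    obtain ⟨h1, h2⟩ := h.of_cons
    exact ⟨⟨by omega, h1⟩, by rw [hgw, h2, hg u h1.zero]⟩
  · rintro r w u i ⟨hr, h⟩ hu
    rw [child?_eq_some] at hu ⊢
    obtain ⟨h1, h2⟩ := h.cons (by omega) i
    rw [← hu] at h1 h2
    exact ⟨⟨by omega, h1⟩, by rw [hg w h.zero, hg u h1.zero, h2]⟩

end Algorithm

/-! ### Labels along a path with no low labels hanging off it. -/

namespace PolyLabel

variable {k : ℕ}

/-- `a_j` and `b_j` with `j ≤ i`, and `x_j` with `j < i`. -/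
def Low (i : ℕ) : PolyLabel k → Prop
  | a j _ _ => j ≤ i
  | b j _ _ => j ≤ i
  | x j _ _ => j < i

theorem not_low_zero (l : PolyLabel k) : ¬ Low 0 l := by
  cases l <;> simp only [Low] <;> omega

theorem low_self (l : PolyLabel k) : Low k l := by
  cases l <;> simpa only [Low]

theorem low_of_index_lt {i j : ℕ} {l : PolyLabel k} (h : l.index < j) (hj : j ≤ i) : Low i l := by
  cases l <;> simp only [Low, index] at * <;> omega

/-- `a_i` or `b_i`. -/
def ab (i : ℕ) (h₁ : 1 ≤ i) (h₂ : i ≤ k) : Bool → PolyLabel k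
  | true => a i h₁ h₂
  | false => b i h₁ h₂

theorem ab_injective {i : ℕ} {h₁ : 1 ≤ i} {h₂ : i ≤ k} : Function.Injective (ab i h₁ h₂) := by
  intro s s' h
  cases s <;> cases s' <;> simp [ab] at h ⊢

theorem index_ab {i : ℕ} (h₁ : 1 ≤ i) (h₂ : i ≤ k) (s : Bool) : (ab i h₁ h₂ s).index = i := by
  cases s <;> rfl

theorem low_ab {i j : ℕ} (h₁ : 1 ≤ i) (h₂ : i ≤ k) (s : Bool) (hj : i ≤ j) :
    Low j (ab i h₁ h₂ s) := by
  cases s <;> exact hj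

theorem allowed_ab {i : ℕ} {h₁ : 1 ≤ i} {h₂ : i ≤ k} {s : Bool} {l l' : PolyLabel k} :
    Allowed (ab i h₁ h₂ s) l l' ↔
      (l.index < i ∨ l = ab i h₁ h₂ !s) ∧ (l'.index < i ∨ l' = ab i h₁ h₂ !s) := by
  cases s <;> rfl

theorem eq_ab_or_eq_x (l : PolyLabel k) :
    (∃ h₁ h₂ s, l = ab l.index h₁ h₂ s) ∨ ∃ h₁ h₂, l = x l.index h₁ h₂ := by
  cases l with
  | a i h₁ h₂ => exact Or.inl ⟨h₁, h₂, true, rfl⟩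
  | b i h₁ h₂ => exact Or.inl ⟨h₁, h₂, false, rfl⟩
  | x i h₁ h₂ => exact Or.inr ⟨h₁, h₂, rfl⟩

section Path

variable {i L : ℕ} {p h : ℕ → PolyLabel k}

/-- An index at most `i` cannot belong to `a` or `b`, whose condition would make the hanging child
low. For `x` the constrained child must be the next path node, and with a strictly smaller index.
The index would thus decrease along the path until it runs out, for which `m` further steps are
enough room. -/
theorem index_path_gt
    (hA : ∀ j < L, Allowed (p j) (p (j + 1)) (h j) ∨ Allowed (p j) (h j) (p (j + 1)))
    (hh : ∀ j < L, ¬ Low i (h j)) (m : ℕ) :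
    ∀ j, (p j).index = m → j + m < L → i < m := by
  have hab : ∀ j < L, (p j).index ≤ i → ∀ h₁ h₂ s, p j ≠ ab (p j).index h₁ h₂ s := by
    intro j hj hi h₁ h₂ s he
    have := hA j hj
    rw [he, allowed_ab, allowed_ab] at this
    rcases this.elim And.right And.left with h' | h'
    · exact hh j hj (low_of_index_lt h' hi)
    · exact hh j hj (h' ▸ low_ab _ _ _ hi)
  induction m using Nat.strong_induction_on with
  | _ m ih =>
    rintro j rfl hj
    by_contra! hi
    rcases eq_ab_or_eq_x (p j) with ⟨h₁, h₂, s, he⟩ | ⟨h₁, h₂, he⟩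
    · exact hab j (by omega) hi _ _ _ he
    · have key : ∀ l : PolyLabel k, (l.index < (p j).index ∨ l = a _ h₁ h₂.le ∨ l = b _ h₁ h₂.le) →
          l = h j ∨ l = p (j + 1) → False := by
        rintro l hl (rfl | rfl)
        · refine hh j (by omega) ?_
          rcases hl with hl | hl | hl
          · exact low_of_index_lt hl hi
          · exact hl ▸ hi
          · exact hl ▸ hi
        · have habs : ∀ s, p (j + 1) ≠ ab (p j).index h₁ h₂.le s := by
            intro s hs
            have hidx : (p (j + 1)).index = (p j).index := by
              have := congrArg index hs
              rwa [index_ab] at this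
            have := hab (j + 1) (by omega) (by omega) (by omega) (by omega) s
            simp only [hidx] at this
            exact this hs
          rcases hl with hl | hl | hl
          · have := ih _ hl (j + 1) rfl (by omega)
            omega
          · exact habs true hl
          · exact habs false hl
      have := hA j (by omega)
      rw [he] at this
      exact this.elim (fun h => key _ h (Or.inl rfl)) fun h => key _ h (Or.inr rfl)

/-- The first label is low of level `i + 1` with index above `i`, which leaves only `a_{i+1}` and
`b_{i+1}`. From there on smaller indices are excluded, so the next path node must take the other
letter. -/
theorem path_alternates (h₁ : 1 ≤ i + 1) (h₂ : i + 1 ≤ k)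
    (hA : ∀ j < L, Allowed (p j) (p (j + 1)) (h j) ∨ Allowed (p j) (h j) (p (j + 1)))
    (hh : ∀ j < L, ¬ Low i (h j)) (h0 : Low (i + 1) (p 0)) (hL : i + 1 < L) :
    ∃ s, ∀ j, 2 * j + 1 + i < L →
      p (2 * j) = ab (i + 1) h₁ h₂ s ∧ p (2 * j + 1) = ab (i + 1) h₁ h₂ !s := by
  have step : ∀ j s, j + 1 + i < L → p j = ab (i + 1) h₁ h₂ s → p (j + 1) = ab (i + 1) h₁ h₂ !s := by
    intro j s hj hp
    have := hA j (by omega)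
    rw [hp, allowed_ab, allowed_ab] at this
    refine (this.elim And.left And.right).resolve_left fun h' => ?_
    have := index_path_gt hA hh _ (j + 1) rfl (by omega)
    omega
  have start : ∃ s, p 0 = ab (i + 1) h₁ h₂ s := by
    have hlt : i < (p 0).index := by
      by_contra! hi
      exact absurd (index_path_gt hA hh _ 0 rfl (by omega)) (by omega)
    cases hp : p 0 with
    | a j h₃ h₄ =>
      rw [hp] at h0 hlt
      obtain rfl : j = i + 1 := le_antisymm h0 hlt
      exact ⟨true, rfl⟩
    | b j h₃ h₄ =>
      rw [hp] at h0 hlt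
      obtain rfl : j = i + 1 := le_antisymm h0 hlt
      exact ⟨false, rfl⟩
    | x j h₃ h₄ =>
      rw [hp] at h0 hlt
      simp only [Low, index] at h0 hlt
      omega
  obtain ⟨s, hs⟩ := start
  refine ⟨s, fun j => ?_⟩
  induction j with
  | zero => exact fun h => ⟨hs, step 0 s (by omega) hs⟩
  | succ j ih =>
    intro hj
    have h1 := step _ _ (by omega) (ih (by omega)).2
    rw [Bool.not_not] at h1
    exact ⟨h1, step _ _ (by omega) h1⟩

end Path

end PolyLabel

/-! ### Probabilities of low labels and the lower bound. -/

namespace LowerBound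

open FullTree PolyLabel

variable {k : ℕ}

/-- The node with a given address (the root if there is no such node). -/
def nodeAt (t : FullTree 2) (p : List (Fin 2)) : t.Node :=
  if h : p ∈ t.nodes then ⟨p, h⟩ else ⟨[], t.nil_mem_nodes⟩

theorem nodeAt_val {t : FullTree 2} {p : List (Fin 2)} (h : p ∈ t.nodes) : (nodeAt t p).1 = p := by
  rw [nodeAt, dif_pos h]

theorem allowed_of_isSolution {t : FullTree 2} {lab : t.Node → PolyLabel k}
    (h : (polyProblem k).IsSolution t lab) {v w w' : t.Node} (hw : t.child? v 0 = some w)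
    (hw' : t.child? v 1 = some w') :
    Allowed (lab v) (lab w) (lab w') ∨ Allowed (lab v) (lab w') (lab w) := by
  have h' : ∀ (v : t.Node) (w : Fin 2 → t.Node), (∀ i, t.child? v i = some (w i)) →
    ∃ ρ : Equiv.Perm (Fin 2), Allowed (lab v) (lab (w (ρ 0))) (lab (w (ρ 1))) := h
  obtain ⟨ρ, hρ⟩ := h' v ![w, w'] (by intro i; fin_cases i <;> assumption)
  have hne : ρ 0 ≠ ρ 1 := fun h => absurd (ρ.injective h) (by decide)
  rcases Fin.exists_fin_two.1 ⟨ρ 0, rfl⟩ with h0 | h0 <;>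
    rcases Fin.exists_fin_two.1 ⟨ρ 1, rfl⟩ with h1 | h1 <;> rw [h0, h1] at hne hρ
  · exact absurd rfl hne
  · exact Or.inl hρ
  · exact Or.inr hρ
  · exact absurd rfl hne

instance : IsProbabilityMeasure coinStream := by
  unfold coinStream
  infer_instance

/-- The streams are independent and identically distributed, so permuting the nodes preserves the
law. Going through a measurable equivalence covers nonmeasurable `S` too, as failure events need not
be measurable. -/
theorem measure_preimage_comp {V : Type} [Fintype V] (g : V ≃ V) (S : Set (V → ℕ → Bool)) :
    (Measure.pi fun _ : V => coinStream) {ω | ω ∘ g.symm ∈ S} =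
      (Measure.pi fun _ : V => coinStream) S := by
  have h := measurePreserving_piCongrLeft (α := fun _ : V => ℕ → Bool) (fun _ => coinStream) g
  rw [← h.measure_preimage_equiv S]
  congr 1
  ext ω
  have : MeasurableEquiv.piCongrLeft (fun _ : V => ℕ → Bool) g ω = ω ∘ g.symm := by
    funext v
    obtain ⟨u, rfl⟩ := g.surjective v
    rw [MeasurableEquiv.coe_piCongrLeft, Equiv.piCongrLeft_apply_apply]
    simp
  rw [Set.mem_preimage, this]
  rfl

theorem validIds_comp {c : ℕ} {t : FullTree 2} {ident : t.Node → ℕ} (h : ValidIds c t ident)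
    (g : t.Node ≃ t.Node) : ValidIds c t (ident ∘ g) :=
  ⟨h.1.comp g.injective, fun v => h.2 (g v)⟩

variable {t H D : FullTree 2} {v : List (Fin 2)} {L T i c : ℕ}

theorem path_alternates_of_isSolution (ht : t.SubtreeAt v (spine H D L)) (h₂ : i + 1 ≤ k)
    (hL : i + 1 < L) {lab : t.Node → PolyLabel k} (hlab : (polyProblem k).IsSolution t lab)
    (hh : ∀ j < L, ¬ Low i (lab (nodeAt t (1 :: pathAddr v j))))
    (h0 : Low (i + 1) (lab (nodeAt t v))) :
    ∃ s, ∀ j, 2 * j + 1 + i < L →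
      lab (nodeAt t (pathAddr v (2 * j))) = ab (i + 1) i.succ_pos h₂ s ∧
      lab (nodeAt t (pathAddr v (2 * j + 1))) = ab (i + 1) i.succ_pos h₂ !s := by
  refine path_alternates (p := fun j => lab (nodeAt t (pathAddr v j)))
    (h := fun j => lab (nodeAt t (1 :: pathAddr v j))) i.succ_pos h₂ (fun j hj => ?_) hh h0 hL
  have h1 := nodeAt_val (ht.pathAddr hj.le).mem
  refine allowed_of_isSolution hlab ?_ ?_
  · rw [child?_eq_some, h1, nodeAt_val (ht.pathAddr hj).mem]; rfl
  · rw [child?_eq_some, h1, nodeAt_val (ht.hanging hj).mem]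

/-- If the roots of the subtrees hanging off a long path are rarely low, then the first node of the
path is rarely low on the next level. -/
theorem measure_low_spine_le (A : Algorithm 2 (PolyLabel k)) {ε₀ ε : ENNReal}
    (hsol : ∀ ident, ValidIds c t ident → (Measure.pi fun _ : t.Node => coinStream)
      {ω | ¬ (polyProblem k).IsSolution t (A.result t ident ω T)} ≤ ε₀)
    (hH : ∀ ident, ValidIds c t ident → ∀ u, t.SubtreeAt u H →
      (Measure.pi fun _ : t.Node => coinStream)
        {ω | Low i (A.result t ident ω T (nodeAt t u))} ≤ ε)
    (hi : i + 1 ≤ k) (hL : 3 * T + k + 4 ≤ L) {ident : t.Node → ℕ} (hid : ValidIds c t ident)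
    (ht : t.SubtreeAt v (spine H D L)) :
    (Measure.pi fun _ : t.Node => coinStream)
      {ω | Low (i + 1) (A.result t ident ω T (nodeAt t v))} ≤ 2 * (ε₀ + L * ε) := by
  set μ := Measure.pi fun _ : t.Node => coinStream
  obtain ⟨g, hg⟩ := exists_equiv_shift ht (T := T) (by omega)
  let bad (ident : t.Node → ℕ) : Set (t.Node → ℕ → Bool) :=
    {ω | ¬ (polyProblem k).IsSolution t (A.result t ident ω T)} ∪
      ⋃ j ∈ Finset.range L, {ω | Low i (A.result t ident ω T (nodeAt t (1 :: pathAddr v j)))}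
  have hbad : ∀ ident, ValidIds c t ident → μ (bad ident) ≤ ε₀ + L * ε := by
    intro ident hid
    refine (measure_union_le _ _).trans (add_le_add (hsol ident hid) ?_)
    refine (measure_biUnion_finset_le _ _).trans ?_
    refine (Finset.sum_le_sum fun j hj =>
      hH ident hid _ (ht.hanging (Finset.mem_range.1 hj))).trans ?_
    simp
  have halt : ∀ ident ω, ω ∉ bad ident → Low (i + 1) (A.result t ident ω T (nodeAt t v)) →
      ∃ s, ∀ j, 2 * j + 1 + i < L →
        A.result t ident ω T (nodeAt t (pathAddr v (2 * j))) = ab (i + 1) i.succ_pos hi s ∧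
        A.result t ident ω T (nodeAt t (pathAddr v (2 * j + 1))) =
          ab (i + 1) i.succ_pos hi !s := by
    intro ident ω hω h0
    simp only [bad, Set.mem_union, Set.mem_ofPred_eq, Set.mem_iUnion, Finset.mem_range, not_or,
      not_not, not_exists] at hω
    exact path_alternates_of_isSolution ht hi (by omega) hω.1 hω.2 h0
  -- If neither the original nor the permuted run is bad, a low first node makes both runs alternate
  -- with the same start; the shift then contradicts parity. The bounds must hold for all
  -- identifiers because the second run uses permuted ones.
  have hsub : {ω | Low (i + 1) (A.result t ident ω T (nodeAt t v))} ⊆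
      bad ident ∪ {ω | ω ∘ g.symm ∈ bad (ident ∘ g.symm)} := by
    intro ω hω
    by_contra hc
    simp only [Set.mem_union, not_or] at hc
    have hroot : A.result t (ident ∘ g.symm) (ω ∘ g.symm) T (nodeAt t v) =
        A.result t ident ω T (nodeAt t v) := by
      have hz : Zone v T T (nodeAt t v).1 := by
        rw [nodeAt_val ht.mem]
        exact Or.inl (pathAddr_not_suffix (i := 0) v (by omega))
      have := A.run_shift ht (by omega) hg ident ω hz
      have hgv : g (nodeAt t v) = nodeAt t v := by
        refine Subtype.ext ?_
        rw [hg _ hz.zero, nodeAt_val ht.mem]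
        exact shift_of_not_suffix (pathAddr_not_suffix (i := 0) v (by omega))
      rw [hgv] at this
      exact congrArg A.output this
    have hdeep : A.result t (ident ∘ g.symm) (ω ∘ g.symm) T (nodeAt t (pathAddr v (2 * T + 2))) =
        A.result t ident ω T (nodeAt t (pathAddr v (2 * T + 1))) := by
      have hm := nodeAt_val (ht.pathAddr (j := 2 * T + 1) (by omega)).mem
      have hz : Zone v T T (nodeAt t (pathAddr v (2 * T + 1))).1 := by
        rw [hm]
        exact Or.inr ⟨pathAddr_suffix v (by omega), pathAddr_not_suffix v (by omega)⟩
      have := A.run_shift ht (by omega) hg ident ω hz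
      have hgv : g (nodeAt t (pathAddr v (2 * T + 1))) = nodeAt t (pathAddr v (2 * T + 2)) := by
        refine Subtype.ext ?_
        rw [hg _ hz.zero, hm, nodeAt_val (ht.pathAddr (by omega)).mem,
          show 2 * T + 1 = T + (T + 1) by ring, pathAddr_add, shift_append, ← pathAddr_add]
        congr 1
        ring
      rw [hgv] at this
      exact congrArg A.output this
    obtain ⟨s, hs⟩ := halt ident ω hc.1 hω
    obtain ⟨s', hs'⟩ := halt (ident ∘ g.symm) (ω ∘ g.symm) hc.2 (by rw [hroot]; exact hω)
    have e0 : ab (i + 1) i.succ_pos hi s' = ab (i + 1) i.succ_pos hi s := by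
      rw [← (hs 0 (by omega)).1, ← (hs' 0 (by omega)).1]
      exact hroot
    -- The same output is read at the odd position `2 * T + 1` in one run and at the even position
    -- `2 * T + 2` in the other.
    have e1 : ab (i + 1) i.succ_pos hi s' = ab (i + 1) i.succ_pos hi !s := by
      rw [← (hs T (by omega)).2, ← (hs' (T + 1) (by omega)).1]
      exact hdeep
    have := ab_injective (e0.symm.trans e1)
    cases s <;> simp at this
  calc μ _ ≤ μ (bad ident ∪ {ω | ω ∘ g.symm ∈ bad (ident ∘ g.symm)}) := measure_mono hsub
    _ ≤ μ (bad ident) + μ {ω | ω ∘ g.symm ∈ bad (ident ∘ g.symm)} := measure_union_le _ _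
    _ = μ (bad ident) + μ (bad (ident ∘ g.symm)) := by
        congr 1
        exact measure_preimage_comp g _
    _ ≤ (ε₀ + L * ε) + (ε₀ + L * ε) :=
        add_le_add (hbad _ hid) (hbad _ (validIds_comp hid g.symm))
    _ = 2 * (ε₀ + L * ε) := (two_mul _).symm

/-- Numerators of the bounds on the probability of being low. -/
def lowBound (L : ℕ) : ℕ → ℕ
  | 0 => 0
  | i + 1 => 2 * (1 + L * lowBound L i)

/-- The strict inequality absorbs the additive term: `2 * L + 2 * L * ((4 * L) ^ i - 1) = 2 * L * (4
* L) ^ i`. -/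
theorem mul_lowBound_lt {L : ℕ} (hL : 1 ≤ L) (i : ℕ) : L * lowBound L i < (4 * L) ^ i := by
  induction i with
  | zero => simp [lowBound]
  | succ i ih =>
    rw [lowBound, pow_succ]
    nlinarith [Nat.mul_le_mul_left L (Nat.succ_le_of_lt ih),
      Nat.mul_pos hL (pow_pos (show 0 < 4 * L by omega) i)]

theorem lowBound_succ_div (L i n : ℕ) :
    2 * (1 / (n : ENNReal) + L * ((lowBound L i : ℕ) / n)) = (lowBound L (i + 1) : ℕ) / n := by
  rw [← mul_div_assoc, ENNReal.div_add_div_same, ← mul_div_assoc, lowBound]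
  push_cast
  rfl

theorem measure_low_nested_le (A : Algorithm 2 (PolyLabel k))
    (hsol : ∀ ident, ValidIds c t ident → (Measure.pi fun _ : t.Node => coinStream)
      {ω | ¬ (polyProblem k).IsSolution t (A.result t ident ω T)} ≤ 1 / (t.size : ENNReal))
    (hL : 3 * T + k + 4 ≤ L) (i : ℕ) (hi : i ≤ k) :
    ∀ ident, ValidIds c t ident → ∀ u, t.SubtreeAt u (nested L i) →
      (Measure.pi fun _ : t.Node => coinStream)
        {ω | Low i (A.result t ident ω T (nodeAt t u))} ≤ (lowBound L i : ℕ) / (t.size : ENNReal) := by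
  induction i with
  | zero => intro ident _ u _; simp [not_low_zero]
  | succ i ih =>
    intro ident hid u hu
    rw [← lowBound_succ_div]
    exact measure_low_spine_le A hsol (ih (by omega)) hi hL hid hu

theorem exists_validIds (hc : 1 ≤ c) (t : FullTree 2) : ∃ ident, ValidIds c t ident := by
  let e := Fintype.equivFin t.Node
  refine ⟨fun v => e v + 1, fun v w h => e.injective (Fin.ext (by simpa using h)), fun v =>
    ⟨Nat.le_add_left 1 _, ?_⟩⟩
  have h1 : (e v : ℕ) < t.size := (e v).2.trans_eq (Fintype.card_coe _)
  exact h1.trans_le (Nat.le_self_pow (by omega) _)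

/-- No algorithm has a running time that is small compared to a length `L` for which nested spines
of that length fit into `n` nodes. -/
theorem not_solves (hk : 1 ≤ k) (hc : 1 ≤ c) {A : Algorithm 2 (PolyLabel k)} {T : ℕ → ℕ}
    (h : Solves .LOCAL .randomized c (polyProblem k) A T) {n L : ℕ} (hn : Odd n)
    (hsize : (2 * L + 1) ^ k ≤ n) (hL : 3 * T n + k + 4 ≤ L) : L < 2 ^ k := by
  obtain ⟨i, rfl⟩ : ∃ i, k = i + 1 := ⟨k - 1, by omega⟩
  obtain ⟨D, hD⟩ := exists_spine_nested_size_eq hn hsize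
  set t := spine (nested L i) D L with ht
  subst hD
  have hsol : ∀ ident, ValidIds c t ident → (Measure.pi fun _ : t.Node => coinStream)
      {ω | ¬ (polyProblem (i + 1)).IsSolution t (A.result t ident ω (T t.size))} ≤
        1 / (t.size : ENNReal) := fun ident hid => h.2 t ident hid
  obtain ⟨ident, hid⟩ := exists_validIds hc t
  have hle := measure_low_spine_le A hsol (measure_low_nested_le A hsol hL i (by omega)) le_rfl hL
    hid (v := []) (ht ▸ subtreeAt_nil t)
  rw [lowBound_succ_div] at hle
  -- At the top level every label is low, so the bound just obtained is at least `1`, that is,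
  -- `t.size ≤ lowBound L (i + 1)`.
  have huniv : {ω | Low (i + 1) (A.result t ident ω (T t.size) (nodeAt t []))} = Set.univ :=
    Set.eq_univ_of_forall fun ω => low_self _
  rw [huniv, measure_univ] at hle
  have hpos : 0 < t.size := Finset.card_pos.2 ⟨[], t.nil_mem_nodes⟩
  rw [ENNReal.le_div_iff_mul_le (Or.inl (by simpa using hpos.ne')) (Or.inl (by simp)),
    one_mul, Nat.cast_le] at hle
  have h1 := mul_lowBound_lt (show 1 ≤ L by omega) (i + 1)
  have h2 : (4 * L) ^ (i + 1) ≤ 2 ^ (i + 1) * t.size := by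
    calc (4 * L) ^ (i + 1) = 2 ^ (i + 1) * (2 * L) ^ (i + 1) := by rw [← mul_pow]; ring
      _ ≤ 2 ^ (i + 1) * t.size :=
        Nat.mul_le_mul_left _ ((Nat.pow_le_pow_left (by omega) _).trans hsize)
  have h3 : L * t.size < 2 ^ (i + 1) * t.size :=
    ((Nat.mul_le_mul_left L hle).trans_lt h1).trans_le h2
  exact lt_of_mul_lt_mul_right h3 (Nat.zero_le _)

theorem rounds_ge (hk : 1 ≤ k) (hc : 1 ≤ c) {A : Algorithm 2 (PolyLabel k)} {T : ℕ → ℕ}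
    (h : Solves .LOCAL .randomized c (polyProblem k) A T) {n : ℕ} (hn : Odd n)
    (hlarge : (2 ^ (k + 1) + 4 * k + 22) ^ k ≤ n) :
    1 / 12 * (n : ℝ) ^ (1 / (k : ℝ)) ≤ T n := by
  by_contra! hT
  set y : ℝ := (n : ℝ) ^ (1 / (k : ℝ)) with hy
  have hyk : y ^ k = n := by
    rw [hy, one_div, Real.rpow_inv_natCast_pow n.cast_nonneg (by omega)]
  have hy0 : 0 ≤ y := by positivity
  have hylarge : (2 : ℝ) ^ (k + 1) + 4 * k + 22 ≤ y := by
    refine le_of_pow_le_pow_left₀ (n := k) (by omega) hy0 ?_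
    rw [hyk]
    exact_mod_cast hlarge
  have h2k : (0 : ℝ) < 2 ^ k := by positivity
  rw [pow_succ] at hylarge
  have hk0 : (0 : ℝ) ≤ k := k.cast_nonneg
  -- The largest `L` with `2 * L + 1 ≤ y`. If `T n < y / 12`, then `3 * T n + k + 4 ≤ L` follows
  -- from `y / 4 + k + 4 ≤ (y - 3) / 2`, i.e. `4 * k + 22 ≤ y`; the summand `2 ^ (k + 1)` gives `2 ^
  -- k ≤ L`, against `not_solves`.
  set L := ⌊(y - 1) / 2⌋₊ with hL
  have hL1 : (L : ℝ) ≤ (y - 1) / 2 := Nat.floor_le (by linarith)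
  have hL2 : (y - 1) / 2 < L + 1 := Nat.lt_floor_add_one _
  have hsize : (2 * L + 1) ^ k ≤ n := by
    have : ((2 * L + 1 : ℕ) : ℝ) ^ k ≤ n := by
      rw [← hyk]
      refine pow_le_pow_left₀ (by positivity) ?_ k
      push_cast
      linarith
    exact_mod_cast this
  have hLT : 3 * T n + k + 4 ≤ L := by
    have : ((3 * T n + k + 4 : ℕ) : ℝ) ≤ L := by
      push_cast
      linarith
    exact_mod_cast this
  have hlt := not_solves hk hc h hn hsize hLT
  have : (L : ℝ) < 2 ^ k := by exact_mod_cast hlt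
  linarith

end LowerBound

theorem mainTheorem10 (k : ℕ) (hk : 1 ≤ k) (c : ℕ) (hc : 1 ≤ c)
    (b : Bandwidth) (ρ : Randomness) :
    HasRoundComplexityTheta b ρ c (polyProblem k) (fun n => (n : ℝ) ^ (1 / (k : ℝ))) := by
  refine ⟨⟨Peeling.algorithm hk (Peeling.threshold k), _,
    (Peeling.solves_deterministic hk c).of_deterministic_congest b ρ, 6 * k,
    fun n hn => Peeling.rounds_le k hn⟩, 1 / 12, by norm_num,
    (2 ^ (k + 1) + 4 * k + 22) ^ k, ?_⟩
  rintro A T h n hn ⟨t, rfl⟩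
  exact LowerBound.rounds_ge hk hc h.randomized_local (FullTree.odd_size t) hn
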